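/- Let $r,q,a\in\mathbb R$, $\sigma>0$, $b>0$, $0\le R<1$, $0<T_1<T$ and $E\in\mathbb R$. Put $V_b(t)=be^{-a(T-t)}$, $\nu=r-q-a-\frac{\sigma^2}{2}$, $\beta=1-\frac{2(r-q-a)}{\sigma^2}$, \[N(x)=\frac1{\sqrt{2\pi}}\int_{-\infty}^x e^{-y^2/2}\,dy,\qquad N_2(a_1,a_2;\rho)=\frac{1}{2\pi\sqrt{1-\rho^2}}\int_{-\infty}^{a_1}\!\int_{-\infty}^{a_2}e^{-\frac{y_1^2-2\rho y_1y_2+y_2^2}{2(1-\rho^2)}}\,dy_2\,dy_1,\] and, for $t<T$, $V>0$, \[d_1(V,t)=\frac{\ln\frac{V}{V_b(t)}+\nu(T-t)}{\sigma\sqrt{T-t}},\qquad d_2(V,t)=\frac{\ln\frac{V_b(t)}{V}+\nu(T-t)}{\sigma\sqrt{T-t}}.\] The price at time $t<T$ of the zero-coupon bond with face value $1$ and maturity $T$, default barrier $V_b(t)$ and default recovery $Re^{-r(T-t)}$, when the firm value is $V$, is \[B(V,t)=Re^{-r(T-t)}+(1-R)e^{-r(T-t)}\Big[N(d_1(V,t))-\Big(\tfrac{V}{V_b(t)}\Big)^{\beta}N(d_2(V,t))\Big].\]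 Assume $e^{-r(T-T_1)}R<E<e^{-r(T-T_1)}$. Then: (a) There is exactly one number $K\ge V_b(T_1)$ such that, for all $V>V_b(T_1)$, $B(V,T_1)<E$ if $V<K$ and $B(V,T_1)\ge E$ if $V\ge K$. (b) For all $V>V_b(T_1)$, with $d_i=d_i(V,T_1)$, \[(E-B(V,T_1))^+=\Big[E-Re^{-r(T-T_1)}\Big]1\{V<K\}-(1-R)e^{-r(T-T_1)}N(d_1)1\{V<K\}+(1-R)e^{-r(T-T_1)}\Big(\tfrac{V}{V_b(T_1)}\Big)^{\beta}N(d_2)1\{V<K\}.\qquad(*)\] (c) Consider the problem \[\frac{\partial P}{\partial t}+\frac12\sigma^2V^2\frac{\partial^2P}{\partial V^2}+(r-q)V\frac{\partial P}{\partial V}-rP=0,\quad V>V_b(t),\ 0\le t<T_1,\] \[P(V_b(t),t)=0,\quad 0\le t<T_1,\] \[P(V,T_1)=\text{the right-hand side of }(*),\quad V>V_b(T_1),\] whose solution is the price of the put option with exercise price $E$ and maturity $T_1$ on the bond. A solution is a function $P$ that is continuous on $\{(V,t):0\le t\le T_1,\ V\ge V_b(t)\}\setminus\{(V_b(T_1),T_1)\}$,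 has continuous derivatives $P_t$, $P_V$, $P_{VV}$ on $\{V>V_b(t),\ 0\le t<T_1\}$ (with the right derivative in $t$ at $t=0$) and is of polynomial growth in $V$, i.e. $|P(V,t)|\le C(1+V^k)$ for some constants $C$ and $k\in\mathbb N$. The problem has a solution, and every solution is given, for $0\le t<T_1$ and $V\ge V_b(t)$, by \begin{align*} P(V,t)={}&\big[Ee^{-r(T_1-t)}-Re^{-r(T-t)}\big]\Big\{N(b_1)-N(b_2)-\Big(\tfrac{V}{V_b(t)}\Big)^{\beta}\big[N(\tilde b_1)-N(\tilde b_2)\big]\Big\}\\ &-(1-R)e^{-r(T-t)}\Big\{N_2(d,b_1;\rho)-N_2(d,b_2;\rho)-\Big(\tfrac{V}{V_b(t)}\Big)^{\beta}\big[N_2(\tilde d,\tilde b_1;\rho)-N_2(\tilde d,\tilde b_2;\rho)\big]\\ &\quad+\big[N_2(d,-b_1;-\rho)-N_2(d,-b_5;-\rho)\big]-\Big(\tfrac{V}{V_b(t)}\Big)^{\beta}\big[N_2(\tilde d,-\tilde b_1;-\rho)-N_2(\tilde d,-\tilde b_5;-\rho)\big]\Big\}, \end{align*} where $\rho=\sqrt{\frac{T_1-t}{T-t}}$,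 $d=d_1(V,t)$, $\tilde d=d_2(V,t)$ and \[b_1=\frac{\ln\frac{V}{V_b(t)}+\nu(T_1-t)}{\sigma\sqrt{T_1-t}},\quad \tilde b_1=\frac{\ln\frac{V_b(t)}{V}+\nu(T_1-t)}{\sigma\sqrt{T_1-t}},\quad b_2=\frac{\ln\frac VK+(r-q-\frac{\sigma^2}{2})(T_1-t)}{\sigma\sqrt{T_1-t}},\] \[\tilde b_2=\frac{\ln\big(\frac{V_b(T_1)}{K}\cdot\frac{V_b(t)}{V}\big)+\nu(T_1-t)}{\sigma\sqrt{T_1-t}},\quad b_5=-\frac{\ln\big(\frac{V_b(T_1)}{K}\cdot\frac{V_b(t)}{V}\big)-\nu(T_1-t)}{\sigma\sqrt{T_1-t}},\quad \tilde b_5=-\frac{\ln\frac{Ve^{a(T-t)}}{Ke^{a(T-T_1)}}-\nu(T_1-t)}{\sigma\sqrt{T_1-t}}.\] -/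

import Mathlib

open Set Filter Topology

noncomputable section

namespace BondOption

/-- The standard normal distribution function. -/
def N (x : ℝ) : ℝ :=
  1 / √(2 * Real.pi) * ∫ y in Iic x, Real.exp (-y ^ 2 / 2)

/-- The standard bivariate normal distribution function with correlation `ρ`. -/
def N₂ (a₁ a₂ ρ : ℝ) : ℝ :=
  1 / (2 * Real.pi * √(1 - ρ ^ 2)) *
    ∫ y₁ in Iic a₁, ∫ y₂ in Iic a₂,
      Real.exp (-(y₁ ^ 2 - 2 * ρ * y₁ * y₂ + y₂ ^ 2) / (2 * (1 - ρ ^ 2)))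

/-- The constants of the model: short rate `r`, dividend rate `q` and volatility `σ` of the firm
value, default barrier `b * exp (-a * (T - t))`, recovery constant `R`, maturity `T` of the bond,
maturity `T₁` and exercise price `E` of the option on the bond. -/
structure Model where
  r : ℝ
  q : ℝ
  σ : ℝ
  a : ℝ
  b : ℝ
  R : ℝ
  T : ℝ
  T₁ : ℝ
  E : ℝ

namespace Model

variable (m : Model)

/-- The default barrier `V_b(t)`. -/
def barrier (t : ℝ) : ℝ := m.b * Real.exp (-m.a * (m.T - t))

/-- The drift `r - q - a - σ² / 2`. -/
def drift : ℝ := m.r - m.q - m.a - m.σ ^ 2 / 2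

/-- The exponent `1 - 2 (r - q - a) / σ²`. -/
def power : ℝ := 1 - 2 * (m.r - m.q - m.a) / m.σ ^ 2

def d₁ (V t : ℝ) : ℝ :=
  (Real.log (V / m.barrier t) + m.drift * (m.T - t)) / (m.σ * √(m.T - t))

def d₂ (V t : ℝ) : ℝ :=
  (Real.log (m.barrier t / V) + m.drift * (m.T - t)) / (m.σ * √(m.T - t))

/-- The survival probability of the bond. -/
def survival (V t : ℝ) : ℝ :=
  N (m.d₁ V t) - (V / m.barrier t) ^ m.power * N (m.d₂ V t)

/-- The price of the defaultable zero-coupon bond before its maturity. -/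
def bondPrice (V t : ℝ) : ℝ :=
  m.R * Real.exp (-m.r * (m.T - t)) +
    m.survival V t * (1 - m.R) * Real.exp (-m.r * (m.T - t))

/-- `K` is an early redemption boundary. -/
def IsRedemptionBoundary (K : ℝ) : Prop :=
  m.barrier m.T₁ ≤ K ∧ ∀ V, m.barrier m.T₁ < V →
    (V < K → m.bondPrice V m.T₁ < m.E) ∧ (K ≤ V → m.E ≤ m.bondPrice V m.T₁)

/-- The terminal value of the option, in terms of the early redemption boundary `K`. -/
def terminalValue (K V : ℝ) : ℝ :=
  (m.E - m.R * Real.exp (-m.r * (m.T - m.T₁))) * (Iio K).indicator 1 V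
  - (1 - m.R) * Real.exp (-m.r * (m.T - m.T₁)) * N (m.d₁ V m.T₁) * (Iio K).indicator 1 V
  + (1 - m.R) * Real.exp (-m.r * (m.T - m.T₁)) * (V / m.barrier m.T₁) ^ m.power
      * N (m.d₂ V m.T₁) * (Iio K).indicator 1 V

/-- The set of `(V, t)` with `0 ≤ t < T₁` and `V > V_b(t)`, on which the equation is imposed. -/
def domain : Set (ℝ × ℝ) :=
  {z | 0 ≤ z.2 ∧ z.2 < m.T₁ ∧ m.barrier z.2 < z.1}

/-- The domain together with its lateral and terminal boundary, without the corner
`(V_b(T₁), T₁)`, at which the boundary value and the terminal value do not match. -/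
def closedDomain : Set (ℝ × ℝ) :=
  {z | 0 ≤ z.2 ∧ z.2 ≤ m.T₁ ∧ m.barrier z.2 ≤ z.1 ∧ z ≠ (m.barrier m.T₁, m.T₁)}

/-- `P` is a classical solution of the barrier terminal boundary value problem of the put option
(in the class of functions of polynomial growth in `V`). The time derivative at `t = 0` is the
right derivative; at `0 < t < T₁` it is the ordinary one. -/
structure IsPutPrice (K : ℝ) (P : ℝ → ℝ → ℝ) : Prop where
  continuousOn : ContinuousOn (Function.uncurry P) m.closedDomain
  growth : ∃ (C : ℝ) (k : ℕ), ∀ V t, (V, t) ∈ m.closedDomain → |P V t| ≤ C * (1 + V ^ k)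
  equation : ∃ Pt PV PVV : ℝ → ℝ → ℝ,
    ContinuousOn (Function.uncurry Pt) m.domain ∧
    ContinuousOn (Function.uncurry PV) m.domain ∧
    ContinuousOn (Function.uncurry PVV) m.domain ∧
    ∀ V t, (V, t) ∈ m.domain →
      HasDerivWithinAt (fun s => P V s) (Pt V t) (Ico 0 m.T₁) t ∧
      HasDerivAt (fun v => P v t) (PV V t) V ∧
      HasDerivAt (fun v => PV v t) (PVV V t) V ∧
      Pt V t + 1 / 2 * m.σ ^ 2 * V ^ 2 * PVV V t + (m.r - m.q) * V * PV V t - m.r * P V t = 0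
  boundary : ∀ t, 0 ≤ t → t < m.T₁ → P (m.barrier t) t = 0
  terminal : ∀ V, m.barrier m.T₁ < V → P V m.T₁ = m.terminalValue K V

def b₁ (V t : ℝ) : ℝ :=
  (Real.log (V / m.barrier t) + m.drift * (m.T₁ - t)) / (m.σ * √(m.T₁ - t))

def b₁' (V t : ℝ) : ℝ :=
  (Real.log (m.barrier t / V) + m.drift * (m.T₁ - t)) / (m.σ * √(m.T₁ - t))

def b₂ (K V t : ℝ) : ℝ :=
  (Real.log (V / K) + (m.r - m.q - m.σ ^ 2 / 2) * (m.T₁ - t)) / (m.σ * √(m.T₁ - t))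

def b₂' (K V t : ℝ) : ℝ :=
  (Real.log (m.barrier m.T₁ / K * (m.barrier t / V)) + m.drift * (m.T₁ - t))
    / (m.σ * √(m.T₁ - t))

def b₅ (K V t : ℝ) : ℝ :=
  -((Real.log (m.barrier m.T₁ / K * (m.barrier t / V)) - m.drift * (m.T₁ - t))
    / (m.σ * √(m.T₁ - t)))

def b₅' (K V t : ℝ) : ℝ :=
  -((Real.log (V * Real.exp (m.a * (m.T - t)) / (K * Real.exp (m.a * (m.T - m.T₁))))
      - m.drift * (m.T₁ - t)) / (m.σ * √(m.T₁ - t)))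

def corr (t : ℝ) : ℝ := √((m.T₁ - t) / (m.T - t))

/-- The explicit price formula of the put option. -/
def putFormula (K V t : ℝ) : ℝ :=
  (m.E * Real.exp (-m.r * (m.T₁ - t)) - m.R * Real.exp (-m.r * (m.T - t))) *
    (N (m.b₁ V t) - N (m.b₂ K V t)
      - (V / m.barrier t) ^ m.power * (N (m.b₁' V t) - N (m.b₂' K V t)))
  - (1 - m.R) * Real.exp (-m.r * (m.T - t)) *
    (N₂ (m.d₁ V t) (m.b₁ V t) (m.corr t) - N₂ (m.d₁ V t) (m.b₂ K V t) (m.corr t)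
      - (V / m.barrier t) ^ m.power *
        (N₂ (m.d₂ V t) (m.b₁' V t) (m.corr t) - N₂ (m.d₂ V t) (m.b₂' K V t) (m.corr t))
      + (N₂ (m.d₁ V t) (-m.b₁ V t) (-m.corr t) - N₂ (m.d₁ V t) (-m.b₅ K V t) (-m.corr t))
      - (V / m.barrier t) ^ m.power *
        (N₂ (m.d₂ V t) (-m.b₁' V t) (-m.corr t) - N₂ (m.d₂ V t) (-m.b₅' K V t) (-m.corr t)))

end Model

end BondOption

end

/-! With x = ln(V / V_b(t)) the default barrier is fixed at x = 0. In the variables c = x + ν(T₁ -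
t) and S = σ²(T₁ - t), after discounting, the pricing equation is the heat equation h_S = h_cc / 2
(`hasDerivAt_of_isHeat`, `equation_of_isHeat`).

Boundary K: at T₁ the bond price is an increasing affine function of the survival probability, which
increases strictly from 0 at x = 0 to 1 at infinity (`strictMonoOn_survivalProb`,
`tendsto_survivalProb`). The bounds on E say that the critical probability lies in (0, 1), so it is
attained at exactly one k > 0, and K = V_b(T₁) e^k.

Existence and formula: by the method of images, extend the payoff g from (0, k) to negative y by
-e^{βy} g(-y). By the reflection identity `exp_mul_gaussDensity` the Gaussian mean of this extension
vanishes at x = 0 at every time, because β = -2ν/σ² does not depend on time. Its discounted value is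
thus a solution. The integrals over (0, k) of a Gaussian density against N are differences of N₂
(`integral_gauss_mul_N`), and this gives the closed form.

Uniqueness: the discounted difference of two solutions obeys a maximum principle
(`nonpos_of_equation`). Infinity is controlled by a polynomial supersolution. The corner, where
continuity fails, is controlled by a small multiple of a heat kernel which stays bounded below near
the corner and tends to 0 at each earlier time. -/

noncomputable section

namespace BondOption

open MeasureTheory

/-! ### Exponential moments and the heat equation -/

/-- The moment integral `∫_{-L}^{L} exp (α y - γ y²) F(y) dy`. -/
def moment (L : ℝ) (F : ℝ → ℝ) (p : ℝ × ℝ) : ℝ :=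
  ∫ y in Icc (-L) L, Real.exp (p.1 * y - p.2 * y ^ 2) * F y

/-- The linear form `(c, S) ↦ A c + B S`. -/
def linForm (A B : ℝ) : ℝ × ℝ →L[ℝ] ℝ :=
  A • ContinuousLinearMap.fst ℝ ℝ ℝ + B • ContinuousLinearMap.snd ℝ ℝ ℝ

@[simp] lemma linForm_apply (A B : ℝ) (p : ℝ × ℝ) : linForm A B p = A * p.1 + B * p.2 := by
  simp [linForm]

lemma norm_linForm_le (A B : ℝ) : ‖linForm A B‖ ≤ |A| + |B| := by
  refine ContinuousLinearMap.opNorm_le_bound _ (by positivity) fun p => ?_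
  rw [linForm_apply, Real.norm_eq_abs]
  have h1 : |p.1| ≤ ‖p‖ := norm_fst_le p
  have h2 : |p.2| ≤ ‖p‖ := norm_snd_le p
  calc |A * p.1 + B * p.2| ≤ |A| * |p.1| + |B| * |p.2| := by
        rw [← abs_mul, ← abs_mul]; exact abs_add_le _ _
    _ ≤ |A| * ‖p‖ + |B| * ‖p‖ := by gcongr
    _ = _ := by ring

lemma HasFDerivAt.comp_curve {h : ℝ × ℝ → ℝ} {A B : ℝ} {u v : ℝ → ℝ} {u' v' x : ℝ}
    (hh : HasFDerivAt h (linForm A B) (u x, v x)) (hu : HasDerivAt u u' x)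
    (hv : HasDerivAt v v' x) :
    HasDerivAt (fun s => h (u s, v s)) (A * u' + B * v') x := by
  refine (hh.comp_hasDerivAt x (hu.prodMk hv)).congr_deriv ?_
  simp

lemma HasFDerivAt.inv_real {f : ℝ × ℝ → ℝ} {f' : ℝ × ℝ →L[ℝ] ℝ} {p : ℝ × ℝ}
    (hf : HasFDerivAt f f' p) (hp : f p ≠ 0) :
    HasFDerivAt (fun q => (f q)⁻¹) (-(f p ^ 2)⁻¹ • f') p :=
  (hasDerivAt_inv hp).comp_hasFDerivAt p hf

/-- Uniformity in `p` over a unit ball supplies the constant dominating function for differentiating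
under the integral. -/
lemma exp_moment_le {L y : ℝ} (hy : y ∈ Icc (-L) L) {p q : ℝ × ℝ} (hp : dist p q ≤ 1) :
    Real.exp (p.1 * y - p.2 * y ^ 2) ≤ Real.exp ((|q.1| + 1) * L + (|q.2| + 1) * L ^ 2) := by
  have hy' : |y| ≤ L := abs_le.2 hy
  have h1 : |p.1| ≤ |q.1| + 1 := by
    have := (norm_fst_le (p - q)).trans ((dist_eq_norm p q) ▸ hp)
    have h2 := abs_sub_abs_le_abs_sub p.1 q.1
    simp only [Prod.fst_sub, Real.norm_eq_abs] at this
    linarith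
  have h2 : |p.2| ≤ |q.2| + 1 := by
    have := (norm_snd_le (p - q)).trans ((dist_eq_norm p q) ▸ hp)
    have h2 := abs_sub_abs_le_abs_sub p.2 q.2
    simp only [Prod.snd_sub, Real.norm_eq_abs] at this
    linarith
  apply Real.exp_le_exp.2
  have h3 : p.1 * y ≤ (|q.1| + 1) * L := by
    calc p.1 * y ≤ |p.1| * |y| := by rw [← abs_mul]; exact le_abs_self _
      _ ≤ _ := by gcongr
  have h4 : -(p.2 * y ^ 2) ≤ (|q.2| + 1) * L ^ 2 := by
    calc -(p.2 * y ^ 2) ≤ |p.2| * |y| ^ 2 := by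
          rw [← abs_pow, ← abs_mul]; exact neg_le_abs _
      _ ≤ _ := by gcongr
  linarith

lemma integrableOn_moment {L C : ℝ} {F : ℝ → ℝ} (hF : Measurable F)
    (hC : ∀ y ∈ Icc (-L) L, |F y| ≤ C) (p : ℝ × ℝ) :
    IntegrableOn (fun y => Real.exp (p.1 * y - p.2 * y ^ 2) * F y) (Icc (-L) L) := by
  refine Measure.integrableOn_of_bounded
    (M := Real.exp ((|p.1| + 1) * L + (|p.2| + 1) * L ^ 2) * C) (by simp) ?_ ?_
  · exact (Measurable.aestronglyMeasurable (by fun_prop))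
  · filter_upwards [ae_restrict_mem measurableSet_Icc] with y hy
    rw [norm_mul, Real.norm_of_nonneg (Real.exp_pos _).le]
    have := exp_moment_le hy (p := p) (q := p) (by simp)
    gcongr
    exact hC y hy

lemma hasFDerivAt_moment {L C : ℝ} {F : ℝ → ℝ} (hF : Measurable F)
    (hC : ∀ y ∈ Icc (-L) L, |F y| ≤ C) (p : ℝ × ℝ) :
    HasFDerivAt (moment L F)
      (linForm (moment L (fun y => y * F y) p) (-moment L (fun y => y ^ 2 * F y) p)) p := by
  have hC1 : ∀ y ∈ Icc (-L) L, |y * F y| ≤ L * C := fun y hy => by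
    rw [abs_mul]
    have := abs_le.2 hy
    have := hC y hy
    have : 0 ≤ L := (abs_nonneg y).trans ‹_›
    gcongr
  have hC2 : ∀ y ∈ Icc (-L) L, |y ^ 2 * F y| ≤ L ^ 2 * C := fun y hy => by
    rw [abs_mul, abs_pow]
    have := abs_le.2 hy
    have := hC y hy
    gcongr
  have hI1 := integrableOn_moment (by fun_prop) hC1 p
  have hI2 := integrableOn_moment (by fun_prop) hC2 p
  have key := hasFDerivAt_integral_of_dominated_of_fderiv_le (𝕜 := ℝ)
    (μ := volume.restrict (Icc (-L) L)) (s := Metric.ball p 1) (x₀ := p)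
    (F := fun p y => Real.exp (p.1 * y - p.2 * y ^ 2) * F y)
    (F' := fun p y => (Real.exp (p.1 * y - p.2 * y ^ 2) * F y) • linForm y (-y ^ 2))
    (bound := fun _ => Real.exp ((|p.1| + 1) * L + (|p.2| + 1) * L ^ 2) * C * (L + L ^ 2))
    (Metric.ball_mem_nhds p one_pos) ?_ (integrableOn_moment hF hC p) ?_ ?_ ?_ ?_
  · convert! key using 1
    ext
    · simp only [ContinuousLinearMap.comp_apply, ContinuousLinearMap.inl_apply, linForm_apply]
      rw [ContinuousLinearMap.integral_apply]
      · simp only [_root_.smul_apply, linForm_apply, moment, smul_eq_mul]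
        simp only [mul_one, mul_zero, add_zero]
        congr 1; ext y; ring
      · have := (hI1.smul_const (ContinuousLinearMap.fst ℝ ℝ ℝ)).sub
          (hI2.smul_const (ContinuousLinearMap.snd ℝ ℝ ℝ))
        refine this.congr (.of_forall fun y => ?_)
        ext <;> simp <;> ring
    · simp only [ContinuousLinearMap.comp_apply, ContinuousLinearMap.inr_apply, linForm_apply]
      rw [ContinuousLinearMap.integral_apply]
      · simp only [_root_.smul_apply, linForm_apply, moment, smul_eq_mul]
        simp only [mul_one, mul_zero, zero_add]
        rw [← integral_neg]
        congr 1; ext y; ring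
      · have := (hI1.smul_const (ContinuousLinearMap.fst ℝ ℝ ℝ)).sub
          (hI2.smul_const (ContinuousLinearMap.snd ℝ ℝ ℝ))
        refine this.congr (.of_forall fun y => ?_)
        ext <;> simp <;> ring
  · exact .of_forall fun q => Measurable.aestronglyMeasurable (by fun_prop)
  · refine AEStronglyMeasurable.fun_smul ?_ ?_
    · exact Measurable.aestronglyMeasurable (by fun_prop)
    · apply Continuous.aestronglyMeasurable
      unfold linForm
      fun_prop
  · filter_upwards [ae_restrict_mem measurableSet_Icc] with y hy q hq
    have h1 := exp_moment_le hy (p := q) (q := p) (Metric.mem_ball.1 hq).le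
    have h2 := hC y hy
    have h3 : |y| ≤ L := abs_le.2 hy
    have h4 : ‖linForm y (-y ^ 2)‖ ≤ L + L ^ 2 := by
      refine (norm_linForm_le _ _).trans ?_
      rw [abs_neg, abs_pow]
      gcongr
    rw [norm_smul, norm_mul, Real.norm_of_nonneg (Real.exp_pos _).le, Real.norm_eq_abs]
    have : 0 ≤ C := (abs_nonneg _).trans h2
    gcongr
  · exact integrable_const _
  · filter_upwards with y q _
    have h1 : HasFDerivAt (fun q : ℝ × ℝ => q.1 * y - q.2 * y ^ 2) (linForm y (-y ^ 2)) q := by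
      have := (linForm y (-y ^ 2)).hasFDerivAt (x := q)
      refine this.congr_of_eventuallyEq (.of_forall fun z => ?_)
      rw [linForm_apply]; ring
    have h2 := h1.exp.mul_const (F y)
    refine h2.congr_fderiv ?_
    rw [smul_smul, mul_comm]

/-- `h` solves the heat equation `h_S = h_cc / 2` for `S > 0`, with `h_c = h₁` and `h_cc = h₂`. -/
structure IsHeat (h h₁ h₂ : ℝ × ℝ → ℝ) : Prop where
  hasFDerivAt : ∀ p : ℝ × ℝ, 0 < p.2 → HasFDerivAt h (linForm (h₁ p) (h₂ p / 2)) p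
  hasDerivAt : ∀ c S : ℝ, 0 < S → HasDerivAt (fun c => h₁ (c, S)) (h₂ (c, S)) c
  continuousOn₁ : ContinuousOn h₁ {p | 0 < p.2}
  continuousOn₂ : ContinuousOn h₂ {p | 0 < p.2}

/-- The Gaussian factor of the heat potentials. -/
def gaussFactor (p : ℝ × ℝ) : ℝ := Real.exp (-p.1 ^ 2 / (2 * p.2)) / √p.2

lemma hasFDerivAt_gaussFactor {p : ℝ × ℝ} (hp : 0 < p.2) :
    HasFDerivAt gaussFactor (linForm (gaussFactor p * (-p.1 / p.2))
      (gaussFactor p * (p.1 ^ 2 / (2 * p.2 ^ 2) - 1 / (2 * p.2)))) p := by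
  have hs : √p.2 ≠ 0 := (Real.sqrt_pos.2 hp).ne'
  have hss : √p.2 ^ 2 = p.2 := Real.sq_sqrt hp.le
  have h1 : HasFDerivAt (fun q : ℝ × ℝ => q.1) (ContinuousLinearMap.fst ℝ ℝ ℝ) p := hasFDerivAt_fst
  have h2 : HasFDerivAt (fun q : ℝ × ℝ => q.2) (ContinuousLinearMap.snd ℝ ℝ ℝ) p := hasFDerivAt_snd
  have h3 := HasFDerivAt.inv_real (h2.const_mul 2) (by positivity)
  have h4 := ((h1.pow 2).neg.mul h3).exp
  have h5 := h4.mul (HasFDerivAt.inv_real (h2.sqrt hp.ne') hs)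
  refine h5.congr_fderiv ?_
  ext
  · simp [gaussFactor, div_eq_mul_inv]
    field_simp
  · simp [gaussFactor, div_eq_mul_inv]
    field_simp
    rw [hss]
    ring

/-- Multiplying moments by the Gaussian factor gives solutions of the heat equation. -/
lemma isHeat_of_moments {M₀ M₁ M₂ : ℝ × ℝ → ℝ}
    (h₀ : ∀ p, HasFDerivAt M₀ (linForm (M₁ p) (-M₂ p)) p)
    (h₁ : ∀ α γ, HasDerivAt (fun α => M₁ (α, γ)) (M₂ (α, γ)) α)
    (hc₁ : Continuous M₁) (hc₂ : Continuous M₂) :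
    IsHeat (fun p => gaussFactor p * M₀ (p.1 / p.2, 1 / (2 * p.2)))
      (fun p => gaussFactor p * (-p.1 / p.2 * M₀ (p.1 / p.2, 1 / (2 * p.2)) +
        1 / p.2 * M₁ (p.1 / p.2, 1 / (2 * p.2))))
      (fun p => gaussFactor p * ((p.1 ^ 2 / p.2 ^ 2 - 1 / p.2) * M₀ (p.1 / p.2, 1 / (2 * p.2)) -
        2 * p.1 / p.2 ^ 2 * M₁ (p.1 / p.2, 1 / (2 * p.2)) +
        1 / p.2 ^ 2 * M₂ (p.1 / p.2, 1 / (2 * p.2)))) := by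
  have hc₀ : Continuous M₀ := continuous_iff_continuousAt.2 fun p => (h₀ p).continuousAt
  have hne : ∀ p ∈ {p : ℝ × ℝ | 0 < p.2}, p.2 ≠ 0 := fun p hp => ne_of_gt hp
  have hne2 : ∀ p ∈ {p : ℝ × ℝ | 0 < p.2}, 2 * p.2 ≠ 0 := fun p hp =>
    mul_ne_zero two_ne_zero (ne_of_gt hp)
  have hnes : ∀ p ∈ {p : ℝ × ℝ | 0 < p.2}, √p.2 ≠ 0 := fun p hp =>
    (Real.sqrt_pos.2 hp).ne'
  have hne3 : ∀ p ∈ {p : ℝ × ℝ | 0 < p.2}, p.2 ^ 2 ≠ 0 := fun p hp => pow_ne_zero _ (ne_of_gt hp)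
  have hcG : ContinuousOn gaussFactor {p : ℝ × ℝ | 0 < p.2} := fun p hp =>
    (hasFDerivAt_gaussFactor hp).continuousAt.continuousWithinAt
  have hcA : ContinuousOn (fun p : ℝ × ℝ => (p.1 / p.2, 1 / (2 * p.2))) {p : ℝ × ℝ | 0 < p.2} := by
    fun_prop (disch := assumption)
  have hk₀ := hc₀.comp_continuousOn hcA
  have hk₁ := hc₁.comp_continuousOn hcA
  have hk₂ := hc₂.comp_continuousOn hcA
  simp only [Function.comp_def] at hk₀ hk₁ hk₂
  refine ⟨fun p hp => ?_, fun c S hS => ?_, ?_, ?_⟩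
  · have h1 : HasFDerivAt (fun q : ℝ × ℝ => q.1) (ContinuousLinearMap.fst ℝ ℝ ℝ) p :=
      hasFDerivAt_fst
    have h2 : HasFDerivAt (fun q : ℝ × ℝ => q.2) (ContinuousLinearMap.snd ℝ ℝ ℝ) p :=
      hasFDerivAt_snd
    have h3 := h1.mul (HasFDerivAt.inv_real h2 hp.ne')
    have h4 := HasFDerivAt.inv_real (h2.const_mul 2) (mul_pos two_pos hp).ne'
    have h5 := (h₀ (p.1 * p.2⁻¹, (2 * p.2)⁻¹)).comp p (h3.prodMk h4)
    have h6 := (hasFDerivAt_gaussFactor hp).mul h5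
    simp only [div_eq_mul_inv, one_mul]
    refine h6.congr_fderiv ?_
    ext
    · simp
      ring
    · simp
      field_simp
      ring
  · have hG : HasDerivAt (fun c => gaussFactor (c, S)) (gaussFactor (c, S) * (-c / S)) c := by
      have := HasFDerivAt.comp_curve (hasFDerivAt_gaussFactor (p := (c, S)) hS)
        (hasDerivAt_id c) (hasDerivAt_const c S)
      simpa using this
    have hd : HasDerivAt (fun c : ℝ => c / S) (1 / S) c := (hasDerivAt_id c).div_const S
    have hm₀ := HasFDerivAt.comp_curve (h₀ (c / S, 1 / (2 * S))) hd
      (hasDerivAt_const c (1 / (2 * S)))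
    have hm₁ := HasDerivAt.comp c (h₁ (c / S) (1 / (2 * S))) hd
    have := hG.mul (((hasDerivAt_id c).neg.div_const S |>.mul hm₀).add (hm₁.const_mul (1 / S)))
    refine this.congr_deriv ?_
    simp
    field_simp
    ring
  · fun_prop (disch := assumption)
  · fun_prop (disch := assumption)

/-- Since exp(-(c - y)² / (2S)) = exp(-c² / (2S)) exp((c/S) y - y² / (2S)), this function is, up to
a constant, the convolution of `F` on [-L, L] with the heat kernel. -/
lemma isHeat_moment {L C : ℝ} {F : ℝ → ℝ} (hF : Measurable F)
    (hC : ∀ y ∈ Icc (-L) L, |F y| ≤ C) :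
    ∃ h₁ h₂, IsHeat (fun p => gaussFactor p * moment L F (p.1 / p.2, 1 / (2 * p.2))) h₁ h₂ := by
  have hC1 : ∀ y ∈ Icc (-L) L, |y * F y| ≤ L * C := fun y hy => by
    rw [abs_mul]
    have := abs_le.2 hy
    have := hC y hy
    have : 0 ≤ L := (abs_nonneg y).trans ‹_›
    gcongr
  have hC2 : ∀ y ∈ Icc (-L) L, |y ^ 2 * F y| ≤ L ^ 2 * C := fun y hy => by
    rw [abs_mul, abs_pow]
    have := abs_le.2 hy
    have := hC y hy
    gcongr
  have h1 := hasFDerivAt_moment (F := fun y => y * F y) (by fun_prop) hC1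
  have h2 := hasFDerivAt_moment (F := fun y => y ^ 2 * F y) (by fun_prop) hC2
  refine ⟨_, _, isHeat_of_moments (hasFDerivAt_moment hF hC) (fun α γ => ?_)
    (continuous_iff_continuousAt.2 fun p => (h1 p).continuousAt)
    (continuous_iff_continuousAt.2 fun p => (h2 p).continuousAt)⟩
  have := HasFDerivAt.comp_curve (h1 (α, γ)) (hasDerivAt_id α) (hasDerivAt_const α γ)
  refine this.congr_deriv ?_
  simp [pow_two, mul_assoc]

/-- The heat kernel itself: the moments are those of a point mass at 0. -/
lemma isHeat_gaussFactor : ∃ h₁ h₂, IsHeat gaussFactor h₁ h₂ := by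
  have := isHeat_of_moments (M₀ := fun _ => 1) (M₁ := fun _ => 0) (M₂ := fun _ => 0)
    (fun p => (hasFDerivAt_const (1 : ℝ) p).congr_fderiv (by ext <;> simp))
    (fun α γ => hasDerivAt_const _ _) continuous_const continuous_const
  simp only [mul_one] at this
  exact ⟨_, _, this⟩

lemma IsHeat.continuousOn {h h₁ h₂ : ℝ × ℝ → ℝ} (hh : IsHeat h h₁ h₂) :
    ContinuousOn h {p | 0 < p.2} :=
  fun p hp => (hh.hasFDerivAt p hp).continuousAt.continuousWithinAt

/-! ### Change of variables from prices to the heat equation -/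

namespace Model

variable (m : Model)

/-- The drifted logarithmic distance to the barrier. -/
def logPos (V t : ℝ) : ℝ :=
  Real.log V - Real.log m.b + m.a * (m.T - t) + m.drift * (m.T₁ - t)

lemma hasDerivAt_logPos_time (V t : ℝ) :
    HasDerivAt (fun s => m.logPos V s) (-(m.a + m.drift)) t := by
  have h1 := ((hasDerivAt_id t).const_sub m.T).const_mul m.a
  have h2 := ((hasDerivAt_id t).const_sub m.T₁).const_mul m.drift
  have := (h1.const_add (Real.log V - Real.log m.b)).add h2
  refine this.congr_deriv ?_
  ring

lemma hasDerivAt_logPos_space {V : ℝ} (hV : V ≠ 0) (t : ℝ) :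
    HasDerivAt (fun v => m.logPos v t) V⁻¹ V :=
  (((Real.hasDerivAt_log hV).sub_const _).add_const _).add_const _

/-- The pull-back of a solution of the heat equation to the price variables. -/
lemma hasDerivAt_of_isHeat {h h₁ h₂ : ℝ × ℝ → ℝ} (hh : IsHeat h h₁ h₂) {δ V t : ℝ}
    (hV : 0 < V) (hS : 0 < m.σ ^ 2 * (m.T₁ - t) + δ) :
    HasDerivAt (fun s => h (m.logPos V s, m.σ ^ 2 * (m.T₁ - s) + δ))
      (-(m.a + m.drift) * h₁ (m.logPos V t, m.σ ^ 2 * (m.T₁ - t) + δ)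
        - m.σ ^ 2 / 2 * h₂ (m.logPos V t, m.σ ^ 2 * (m.T₁ - t) + δ)) t ∧
    HasDerivAt (fun v => h (m.logPos v t, m.σ ^ 2 * (m.T₁ - t) + δ))
      (h₁ (m.logPos V t, m.σ ^ 2 * (m.T₁ - t) + δ) / V) V ∧
    HasDerivAt (fun v => h₁ (m.logPos v t, m.σ ^ 2 * (m.T₁ - t) + δ) / v)
      ((h₂ (m.logPos V t, m.σ ^ 2 * (m.T₁ - t) + δ)
        - h₁ (m.logPos V t, m.σ ^ 2 * (m.T₁ - t) + δ)) / V ^ 2) V := by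
  have hx := m.hasDerivAt_logPos_space hV.ne' t
  have hfd := hh.hasFDerivAt (m.logPos V t, m.σ ^ 2 * (m.T₁ - t) + δ) hS
  refine ⟨?_, ?_, ?_⟩
  · have h2 := (((hasDerivAt_id t).const_sub m.T₁).const_mul (m.σ ^ 2)).add_const δ
    refine (HasFDerivAt.comp_curve hfd (m.hasDerivAt_logPos_time V t) h2).congr_deriv ?_
    ring
  · refine (HasFDerivAt.comp_curve hfd hx (hasDerivAt_const V _)).congr_deriv ?_
    ring
  · have := (HasDerivAt.comp V (hh.hasDerivAt (m.logPos V t) _ hS) hx).div (hasDerivAt_id V) hV.ne'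
    refine this.congr_deriv ?_
    simp
    field_simp

/-- The second-order terms cancel, and ν = r - q - a - σ²/2 is exactly the drift for which the
first-order terms cancel too. -/
lemma equation_of_isHeat (A B : ℝ) {V : ℝ} (hV : 0 < V) :
    -(m.a + m.drift) * A - m.σ ^ 2 / 2 * B + 1 / 2 * m.σ ^ 2 * V ^ 2 * ((B - A) / V ^ 2)
      + (m.r - m.q) * V * (A / V) = 0 := by
  unfold drift
  field_simp
  ring

end Model

/-! ### Derivative tests at a maximum -/

lemma deriv_right_nonpos_of_max {f : ℝ → ℝ} {f' a b t : ℝ} (ha : a ≤ t) (hb : t < b)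
    (hf : HasDerivWithinAt f f' (Ico a b) t) (hmax : ∀ᶠ s in 𝓝[≥] t, f s ≤ f t) : f' ≤ 0 := by
  have h1 : HasDerivWithinAt f f' (Ioi t) t := by
    have : HasDerivWithinAt f f' (Ioo t b) t := hf.mono fun x hx => ⟨ha.trans hx.1.le, hx.2⟩
    exact this.mono_of_mem_nhdsWithin (Ioo_mem_nhdsGT hb)
  have h2 := (hasDerivWithinAt_iff_tendsto_slope' self_notMem_Ioi).1 h1
  refine le_of_tendsto h2 ?_
  filter_upwards [nhdsWithin_mono t Ioi_subset_Ici_self hmax, self_mem_nhdsWithin] with s hs hst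
  rw [slope_def_field]
  exact div_nonpos_of_nonpos_of_nonneg (by linarith) (sub_nonneg.2 (le_of_lt hst))

/-- If g' > 0, the second derivative test makes the maximum a minimum as well. Then f is locally
constant and g' = 0, a contradiction. -/
lemma second_deriv_nonpos_of_max {f g : ℝ → ℝ} {g' V : ℝ}
    (hf : ∀ᶠ v in 𝓝 V, HasDerivAt f (g v) v) (hg : HasDerivAt g g' V) (hmax : IsLocalMax f V) :
    g V = 0 ∧ g' ≤ 0 := by
  have h0 : g V = 0 := hmax.hasDerivAt_eq_zero hf.self_of_nhds
  refine ⟨h0, ?_⟩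
  by_contra! hpos
  have hd : deriv f =ᶠ[𝓝 V] g := hf.mono fun v hv => hv.deriv
  have hdd : deriv (deriv f) V = g' := by rw [hd.deriv_eq, hg.deriv]
  have hmin := isLocalMin_of_deriv_deriv_pos (f := f) (x₀ := V) (by rw [hdd]; exact hpos)
    (by rw [hd.self_of_nhds, h0]) hf.self_of_nhds.continuousAt
  have hconst : f =ᶠ[𝓝 V] fun _ => f V := by
    filter_upwards [hmax, hmin] with v h1 h2 using le_antisymm h1 h2
  have hg0 : g =ᶠ[𝓝 V] fun _ => (0 : ℝ) := by
    filter_upwards [hf, hconst.eventually_nhds] with v hv hv2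
    have : HasDerivAt f 0 v := (hasDerivAt_const v (f V)).congr_of_eventuallyEq hv2
    exact hv.unique this
  have := (hg.congr_of_eventuallyEq hg0.symm).unique (hasDerivAt_const V (0 : ℝ))
  linarith

/-! ### Comparison functions, maximum principle and uniqueness -/

namespace Model

variable (m : Model)

lemma continuous_barrier : Continuous m.barrier := by unfold barrier; fun_prop

variable {m}

lemma barrier_pos (hb : 0 < m.b) (t : ℝ) : 0 < m.barrier t := mul_pos hb (Real.exp_pos _)

lemma log_div_barrier (hb : 0 < m.b) {V : ℝ} (hV : 0 < V) (t : ℝ) :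
    Real.log (V / m.barrier t) = Real.log V - Real.log m.b + m.a * (m.T - t) := by
  rw [Real.log_div hV.ne' (barrier_pos hb t).ne', barrier,
    Real.log_mul hb.ne' (Real.exp_pos _).ne', Real.log_exp]
  ring

lemma logPos_eq (hb : 0 < m.b) {V : ℝ} (hV : 0 < V) (t : ℝ) :
    m.logPos V t = Real.log (V / m.barrier t) + m.drift * (m.T₁ - t) := by
  rw [log_div_barrier hb hV, logPos]

variable (m) in
/-- A solution of the equation that blows up at the corner `(V_b(T₁), T₁)` as `η → 0`. -/
def cornerBarrier (η V t : ℝ) : ℝ :=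
  η * gaussFactor (m.logPos V t, m.σ ^ 2 * (m.T₁ - t) + η ^ 2)

lemma cornerBarrier_nonneg {η : ℝ} (hη : 0 ≤ η) (V t : ℝ) : 0 ≤ m.cornerBarrier η V t :=
  mul_nonneg hη (div_nonneg (Real.exp_pos _).le (Real.sqrt_nonneg _))

/-- At a fixed time before T₁ the corner function is O(η), so it disappears in the limit. -/
lemma cornerBarrier_le (hσ : 0 < m.σ) {η t : ℝ} (hη : 0 ≤ η) (ht : t < m.T₁) (V : ℝ) :
    m.cornerBarrier η V t ≤ η * (1 / √(m.σ ^ 2 * (m.T₁ - t))) := by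
  have ht' : 0 < m.T₁ - t := sub_pos.2 ht
  have hpos : 0 < m.σ ^ 2 * (m.T₁ - t) := by positivity
  unfold cornerBarrier gaussFactor
  have h1 : Real.exp (-(m.logPos V t) ^ 2 / (2 * (m.σ ^ 2 * (m.T₁ - t) + η ^ 2))) ≤ 1 := by
    apply Real.exp_le_one_iff.2
    apply div_nonpos_of_nonpos_of_nonneg
    · nlinarith [sq_nonneg (m.logPos V t)]
    · positivity
  have h2 : √(m.σ ^ 2 * (m.T₁ - t)) ≤ √(m.σ ^ 2 * (m.T₁ - t) + η ^ 2) :=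
    Real.sqrt_le_sqrt (by nlinarith)
  have h3 : 0 < √(m.σ ^ 2 * (m.T₁ - t)) := Real.sqrt_pos.2 hpos
  simp only
  gcongr

/-- On a parabolic box of size η at the corner, |c| ≤ (1 + |ν|)η and η² ≤ S ≤ (σ² + 1)η². The
factors η cancel and leave a lower bound independent of η. -/
lemma le_cornerBarrier (hb : 0 < m.b) {η V t : ℝ} (hη : 0 < η) (hη1 : η ≤ 1)
    (ht : t ≤ m.T₁) (ht2 : m.T₁ - t ≤ η ^ 2) (hV : m.barrier t ≤ V)
    (hV2 : V ≤ m.barrier t * Real.exp η) :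
    Real.exp (-(1 + |m.drift|) ^ 2 / 2) / √(m.σ ^ 2 + 1) ≤ m.cornerBarrier η V t := by
  have hB := barrier_pos hb t
  have hV0 : 0 < V := hB.trans_le hV
  have hx0 : 0 ≤ Real.log (V / m.barrier t) := Real.log_nonneg ((one_le_div hB).2 hV)
  have hx1 : Real.log (V / m.barrier t) ≤ η := by
    rw [Real.log_le_iff_le_exp (div_pos hV0 hB), div_le_iff₀ hB]
    linarith
  have hτ : 0 ≤ m.T₁ - t := by linarith
  have hη2 : η ^ 2 ≤ η := by nlinarith
  have hc : |m.logPos V t| ≤ (1 + |m.drift|) * η := by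
    rw [logPos_eq hb hV0]
    calc |_| ≤ |Real.log (V / m.barrier t)| + |m.drift * (m.T₁ - t)| := abs_add_le _ _
      _ = Real.log (V / m.barrier t) + |m.drift| * (m.T₁ - t) := by
        rw [abs_mul, abs_of_nonneg hx0, abs_of_nonneg hτ]
      _ ≤ η + |m.drift| * η := by gcongr; linarith
      _ = _ := by ring
  have hc2 : (m.logPos V t) ^ 2 ≤ (1 + |m.drift|) ^ 2 * η ^ 2 := by
    rw [← sq_abs, ← mul_pow]; gcongr
  have hS1 : η ^ 2 ≤ m.σ ^ 2 * (m.T₁ - t) + η ^ 2 := by nlinarith [sq_nonneg m.σ]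
  have hS2 : m.σ ^ 2 * (m.T₁ - t) + η ^ 2 ≤ η ^ 2 * (m.σ ^ 2 + 1) := by nlinarith [sq_nonneg m.σ]
  have hSp : 0 < m.σ ^ 2 * (m.T₁ - t) + η ^ 2 := by positivity
  unfold cornerBarrier gaussFactor
  have h1 : Real.exp (-(1 + |m.drift|) ^ 2 / 2) ≤
      Real.exp (-(m.logPos V t) ^ 2 / (2 * (m.σ ^ 2 * (m.T₁ - t) + η ^ 2))) := by
    apply Real.exp_le_exp.2
    rw [neg_div, neg_div, neg_le_neg_iff, div_le_div_iff₀ (by positivity) (by positivity)]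
    have : (1 + |m.drift|) ^ 2 * η ^ 2 ≤
      (1 + |m.drift|) ^ 2 * (m.σ ^ 2 * (m.T₁ - t) + η ^ 2) := by gcongr
    linarith
  have h2 : √(m.σ ^ 2 * (m.T₁ - t) + η ^ 2) ≤ η * √(m.σ ^ 2 + 1) := by
    refine (Real.sqrt_le_sqrt hS2).trans ?_
    rw [Real.sqrt_mul (by positivity), Real.sqrt_sq hη.le]
  have h3 : 0 < √(m.σ ^ 2 * (m.T₁ - t) + η ^ 2) := Real.sqrt_pos.2 hSp
  simp only
  rw [← mul_div_assoc, div_le_div_iff₀ (by positivity) h3]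
  calc _ ≤ Real.exp (-(m.logPos V t) ^ 2 / (2 * (m.σ ^ 2 * (m.T₁ - t) + η ^ 2)))
        * (η * √(m.σ ^ 2 + 1)) := by gcongr
    _ = _ := by ring

lemma cornerBarrier_equation {η V t : ℝ} (hη : 0 < η) (hV : 0 < V) (ht : t < m.T₁) :
    ∃ (ht' hVV : ℝ) (hV' : ℝ → ℝ), HasDerivAt (fun s => m.cornerBarrier η V s) ht' t ∧
      (∀ v, 0 < v → HasDerivAt (fun v => m.cornerBarrier η v t) (hV' v) v) ∧
      HasDerivAt hV' hVV V ∧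
      ht' + 1 / 2 * m.σ ^ 2 * V ^ 2 * hVV + (m.r - m.q) * V * hV' V = 0 := by
  obtain ⟨h₁, h₂, hh⟩ := isHeat_gaussFactor
  have hτ : 0 < m.T₁ - t := sub_pos.2 ht
  have hS : 0 < m.σ ^ 2 * (m.T₁ - t) + η ^ 2 := by positivity
  obtain ⟨d1, -, d3⟩ := m.hasDerivAt_of_isHeat hh hV hS
  refine ⟨_, _, _, d1.const_mul η, fun v hv =>
    (m.hasDerivAt_of_isHeat hh hv hS).2.1.const_mul η, d3.const_mul η, ?_⟩
  linear_combination η * m.equation_of_isHeat (h₁ (m.logPos V t, m.σ ^ 2 * (m.T₁ - t) + η ^ 2))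
    (h₂ (m.logPos V t, m.σ ^ 2 * (m.T₁ - t) + η ^ 2)) hV

variable (m) in
/-- A strict supersolution of polynomial growth. -/
def growthBarrier (n : ℕ) (V t : ℝ) : ℝ :=
  Real.exp ((1 + |1 / 2 * m.σ ^ 2 * ((n + 2) * (n + 1)) + (m.r - m.q) * (n + 2)|) * (m.T₁ - t)) *
    (1 + V ^ (n + 2))

/-- V^(n+2) is an eigenfunction of the spatial operator with eigenvalue A; the decay rate 1 + |A| in
time exceeds A and makes the inequality strict. -/
lemma growthBarrier_equation (n : ℕ) {V : ℝ} (hV : 0 < V) (t : ℝ) :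
    ∃ (ht' hVV : ℝ) (hV' : ℝ → ℝ), HasDerivAt (fun s => m.growthBarrier n V s) ht' t ∧
      (∀ v, HasDerivAt (fun v => m.growthBarrier n v t) (hV' v) v) ∧
      HasDerivAt hV' hVV V ∧
      ht' + 1 / 2 * m.σ ^ 2 * V ^ 2 * hVV + (m.r - m.q) * V * hV' V < 0 := by
  unfold growthBarrier
  set A := 1 / 2 * m.σ ^ 2 * ((n + 2 : ℝ) * (n + 1)) + (m.r - m.q) * (n + 2) with hA
  set e := Real.exp ((1 + |A|) * (m.T₁ - t)) with he
  have he0 : 0 < e := Real.exp_pos _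
  have d1 := ((((hasDerivAt_id t).const_sub m.T₁).const_mul (1 + |A|)).exp).mul_const
    (1 + V ^ (n + 2))
  have d2 : ∀ v : ℝ, HasDerivAt (fun v => e * (1 + v ^ (n + 2)))
      (e * ((n + 2 : ℕ) * v ^ (n + 1))) v := fun v => by
    simpa using ((hasDerivAt_pow (n + 2) v).const_add 1).const_mul e
  have d3 : HasDerivAt (fun v : ℝ => e * ((n + 2 : ℕ) * v ^ (n + 1)))
      (e * ((n + 2 : ℕ) * ((n + 1 : ℕ) * V ^ n))) V := by
    simpa using ((hasDerivAt_pow (n + 1) V).const_mul ((n + 2 : ℕ) : ℝ)).const_mul e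
  refine ⟨_, _, _, d1, d2, d3, ?_⟩
  have hP : 0 < V ^ (n + 2) := by positivity
  have : A * V ^ (n + 2) < (1 + |A|) * (1 + V ^ (n + 2)) := by
    have := le_abs_self A
    nlinarith [abs_nonneg A]
  have h2 := mul_lt_mul_of_pos_left this he0
  simp only [id]
  rw [← he]
  push_cast
  rw [hA] at h2
  have e1 : V ^ (n + 2) = V ^ n * V ^ 2 := pow_add _ _ _
  have e2 : V ^ (n + 1) = V ^ n * V := pow_succ _ _
  rw [e1] at h2 ⊢
  rw [e2]
  rw [← hA] at h2
  have e3 : A * (V ^ n * V ^ 2) = 1 / 2 * m.σ ^ 2 * V ^ 2 * ((n + 2) * ((n + 1) * V ^ n)) +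
    (m.r - m.q) * V * ((n + 2) * (V ^ n * V)) := by rw [hA]; ring
  rw [e3] at h2
  linarith

/-- Comparison with the barriers. -/
lemma le_barriers (hb : 0 < m.b) {w wt wV wVV : ℝ → ℝ → ℝ}
    (hc : ContinuousOn (Function.uncurry w) m.closedDomain)
    {C : ℝ} {n : ℕ} (hg : ∀ V t, (V, t) ∈ m.closedDomain → |w V t| ≤ C * (1 + V ^ n))
    (heq : ∀ V t, (V, t) ∈ m.domain →
      HasDerivWithinAt (fun s => w V s) (wt V t) (Ico 0 m.T₁) t ∧
      HasDerivAt (fun v => w v t) (wV V t) V ∧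
      HasDerivAt (fun v => wV v t) (wVV V t) V ∧
      wt V t + 1 / 2 * m.σ ^ 2 * V ^ 2 * wVV V t + (m.r - m.q) * V * wV V t = 0)
    (hlat : ∀ t, 0 ≤ t → t < m.T₁ → w (m.barrier t) t = 0)
    (hter : ∀ V, m.barrier m.T₁ < V → w V m.T₁ = 0)
    {A ε η : ℝ} (hA : 0 ≤ A) (hε : 0 < ε) (hη : 0 < η) (hη1 : η ≤ 1)
    (hAw : ∀ V t, (V, t) ∈ m.closedDomain → V ≤ m.barrier t * Real.exp 1 →
      w V t ≤ A * (Real.exp (-(1 + |m.drift|) ^ 2 / 2) / √(m.σ ^ 2 + 1)))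
    {V₀ t₀ : ℝ} (h₀ : (V₀, t₀) ∈ m.domain) (hbox : η ^ 2 ≤ m.T₁ - t₀) :
    w V₀ t₀ ≤ A * m.cornerBarrier η V₀ t₀ + ε * m.growthBarrier n V₀ t₀ := by
  set W : ℝ → ℝ → ℝ := fun V t =>
    w V t - A * m.cornerBarrier η V t - ε * m.growthBarrier n V t with hW
  suffices W V₀ t₀ ≤ 0 by simp only [hW] at this; linarith
  have hBc := m.continuous_barrier
  -- The cut-off lies beyond V₀ and is so large that at V = X the growth function dominates the
  -- bound C(1 + V^n) on w.
  set X := max (max 1 (2 * C / ε)) (V₀ + 1) with hX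
  -- The domain cut off at X with a box around the corner removed: compact, and inside the region
  -- where w is continuous.
  set S : Set (ℝ × ℝ) := {z | 0 ≤ z.2 ∧ z.2 ≤ m.T₁ ∧ m.barrier z.2 ≤ z.1 ∧ z.1 ≤ X ∧
    (m.barrier z.2 * Real.exp η ≤ z.1 ∨ η ^ 2 ≤ m.T₁ - z.2)} with hS
  have hexp : 1 < Real.exp η := Real.one_lt_exp_iff.2 hη
  have hSsub : S ⊆ m.closedDomain := by
    rintro ⟨V, t⟩ ⟨h1, h2, h3, h4, h5⟩
    refine ⟨h1, h2, h3, fun h => ?_⟩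
    obtain ⟨rfl, rfl⟩ := Prod.mk.inj h
    have := barrier_pos hb m.T₁
    rcases h5 with h5 | h5
    · simp only at h5; nlinarith
    · simp only at h5; nlinarith
  have hSc : IsCompact S := by
    have hclosed : IsClosed S := by
      refine (isClosed_le continuous_const continuous_snd).inter
        ((isClosed_le continuous_snd continuous_const).inter
        ((isClosed_le (hBc.comp continuous_snd) continuous_fst).inter
        ((isClosed_le continuous_fst continuous_const).inter (IsClosed.union ?_ ?_))))
      · exact isClosed_le ((hBc.comp continuous_snd).mul continuous_const) continuous_fst
      · exact isClosed_le continuous_const (continuous_const.sub continuous_snd)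
    refine IsCompact.of_isClosed_subset (s := Icc 0 X ×ˢ Icc 0 m.T₁)
      (isCompact_Icc.prod isCompact_Icc) hclosed ?_
    rintro ⟨V, t⟩ ⟨h1, h2, h3, h4, h5⟩
    exact ⟨⟨(barrier_pos hb t).le.trans h3, h4⟩, h1, h2⟩
  have hWc : ContinuousOn (Function.uncurry W) S := by
    have hne : ∀ z ∈ S, z.1 ≠ 0 := fun z hz => ((barrier_pos hb z.2).trans_le hz.2.2.1).ne'
    have h1 : ContinuousOn (fun z : ℝ × ℝ => m.cornerBarrier η z.1 z.2) S := by
      obtain ⟨h₁, h₂, hh⟩ := isHeat_gaussFactor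
      have hmap : ContinuousOn
          (fun z : ℝ × ℝ => (m.logPos z.1 z.2, m.σ ^ 2 * (m.T₁ - z.2) + η ^ 2)) S := by
        unfold logPos
        fun_prop (disch := assumption)
      refine continuousOn_const.mul (hh.continuousOn.comp hmap fun z hz => ?_)
      have : 0 ≤ m.T₁ - z.2 := sub_nonneg.2 hz.2.1
      simp only [mem_ofPred_eq]
      positivity
    have h2 : Continuous (fun z : ℝ × ℝ => m.growthBarrier n z.1 z.2) := by
      unfold growthBarrier; fun_prop
    exact ((hc.mono hSsub).sub (continuousOn_const.mul h1)).sub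
      (continuous_const.mul h2).continuousOn
  have h₀S : (V₀, t₀) ∈ S := ⟨h₀.1, h₀.2.1.le, h₀.2.2.le,
    (by rw [hX]; exact (le_add_of_nonneg_right zero_le_one).trans (le_max_right _ _)), .inr hbox⟩
  obtain ⟨⟨V, t⟩, hz, hmax⟩ := hSc.exists_isMaxOn ⟨_, h₀S⟩ hWc
  refine (hmax h₀S).trans ?_
  change W V t ≤ 0
  -- A positive maximum cannot lie on the terminal or lateral boundary, at V = X, or on the edge of
  -- the removed box. What remains is interior or at t = 0, where the derivative tests apply.
  by_contra! hpos
  obtain ⟨ht0, htT, hVb, hVX, hout⟩ := hz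
  simp only at ht0 htT hVb hVX hout
  have hB0 := barrier_pos hb t
  have hV0 : 0 < V := hB0.trans_le hVb
  have hcn : 0 ≤ m.cornerBarrier η V t := cornerBarrier_nonneg hη.le V t
  have hgn : 0 < m.growthBarrier n V t := by unfold growthBarrier; positivity
  have hwpos : 0 < w V t - A * m.cornerBarrier η V t - ε * m.growthBarrier n V t := hpos
  have hw0 : 0 < w V t := by nlinarith [mul_nonneg hA hcn, mul_pos hε hgn]
  have hcd := @hSsub (V, t) ⟨ht0, htT, hVb, hVX, hout⟩
  have htT' : t < m.T₁ := by
    refine lt_of_le_of_ne htT fun h => ?_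
    have h1 : m.barrier t * Real.exp η ≤ V := by
      rcases hout with h1 | h1
      · exact h1
      · nlinarith
    have := hter V (by rw [← h]; nlinarith)
    rw [← h] at this
    linarith
  have hVb' : m.barrier t < V := by
    refine lt_of_le_of_ne hVb fun h => ?_
    have := hlat t ht0 htT'
    rw [h] at this
    linarith
  have hVX' : V < X := by
    refine lt_of_le_of_ne hVX fun h => ?_
    have h1 : 1 ≤ V := by rw [h]; exact (le_max_left _ _).trans (le_max_left _ _)
    have h2 : 2 * C / ε ≤ V := by rw [h]; exact (le_max_right _ _).trans (le_max_left _ _)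
    have h3 := (le_abs_self _).trans (hg V t hcd)
    have h4 : (1 + V ^ (n + 2)) ≤ m.growthBarrier n V t := by
      unfold growthBarrier
      refine le_mul_of_one_le_left (by positivity) (Real.one_le_exp ?_)
      have : 0 ≤ m.T₁ - t := by linarith
      positivity
    have h5 : 0 ≤ C := by
      by_contra! hC
      have : C * (1 + V ^ n) < 0 := mul_neg_of_neg_of_pos hC (by positivity)
      linarith
    have h6 : 2 * C ≤ ε * V := by rw [div_le_iff₀ hε] at h2; linarith
    have hVn : 1 ≤ V ^ n := one_le_pow₀ h1
    have h7 : C * (1 + V ^ n) ≤ ε * V ^ (n + 2) := by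
      calc C * (1 + V ^ n) ≤ C * (V ^ n + V ^ n) := by gcongr
        _ = 2 * C * V ^ n := by ring
        _ ≤ ε * V * V ^ n := by gcongr
        _ ≤ ε * V * V ^ n * V := le_mul_of_one_le_right (by positivity) h1
        _ = _ := by ring
    have h8 : ε * (1 + V ^ (n + 2)) ≤ ε * m.growthBarrier n V t := by gcongr
    nlinarith [mul_nonneg hA hcn]
  -- On the edge of the box the lower bound for the corner function meets the bound `hAw` on w, so W
  -- < 0 there.
  have hout' : m.barrier t * Real.exp η < V ∨ η ^ 2 < m.T₁ - t := by
    by_contra! hin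
    have h1 := le_cornerBarrier hb hη hη1 htT hin.2 hVb hin.1
    have h2 := hAw V t hcd (hin.1.trans (by gcongr))
    have h3 := mul_le_mul_of_nonneg_left h1 hA
    nlinarith [mul_pos hε hgn]
  have hdom : (V, t) ∈ m.domain := ⟨ht0, htT', hVb'⟩
  obtain ⟨e1, -, e3, e4⟩ := heq V t hdom
  obtain ⟨ct, cVV, cV, c1, c2, c3, c4⟩ := cornerBarrier_equation (m := m) hη hV0 htT'
  obtain ⟨gt, gVV, gV, g1, g2, g3, g4⟩ := growthBarrier_equation (m := m) n hV0 t
  -- The equation runs backward in time, so only times s ≥ t are compared; this also covers t = 0.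
  have f1 : wt V t - A * ct - ε * gt ≤ 0 := by
    refine deriv_right_nonpos_of_max (f := fun s => W V s) ht0 htT'
      ((e1.sub (c1.const_mul A).hasDerivWithinAt).sub (g1.const_mul ε).hasDerivWithinAt) ?_
    have hev : ∀ᶠ s in 𝓝[≥] t, (V, s) ∈ S := by
      have n1 : ∀ᶠ s in 𝓝 t, s < m.T₁ := eventually_lt_nhds htT'
      have n2 : ∀ᶠ s in 𝓝 t, m.barrier s < V := hBc.continuousAt.eventually_lt_const hVb'
      have n3 : ∀ᶠ s in 𝓝 t, m.barrier s * Real.exp η < V ∨ η ^ 2 < m.T₁ - s := by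
        rcases hout' with h | h
        · have : ContinuousAt (fun s => m.barrier s * Real.exp η) t := by fun_prop
          exact (this.eventually_lt_const h).mono fun _ => .inl
        · have : ContinuousAt (fun s => m.T₁ - s) t := by fun_prop
          exact (this.eventually_const_lt h).mono fun _ => .inr
      filter_upwards [self_mem_nhdsWithin, n1.filter_mono nhdsWithin_le_nhds,
        n2.filter_mono nhdsWithin_le_nhds, n3.filter_mono nhdsWithin_le_nhds] with s a1 a2 a3 a4
      exact ⟨ht0.trans a1, a2.le, a3.le, hVX, a4.imp le_of_lt le_of_lt⟩
    filter_upwards [hev] with s hs using hmax hs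
  have f2 : wV V t - A * cV V - ε * gV V = 0 ∧ wVV V t - A * cVV - ε * gVV ≤ 0 := by
    refine second_deriv_nonpos_of_max (f := fun v => W v t)
      (g := fun v => wV v t - A * cV v - ε * gV v) ?_
      ((e3.sub (c3.const_mul A)).sub (g3.const_mul ε)) ?_
    · filter_upwards [eventually_gt_nhds hVb'] with v hv
      exact ((heq v t ⟨ht0, htT', hv⟩).2.1.sub ((c2 v (hB0.trans hv)).const_mul A)).sub
        ((g2 v).const_mul ε)
    · have n3 : ∀ᶠ v in 𝓝 V, m.barrier t * Real.exp η < v ∨ η ^ 2 < m.T₁ - t := by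
        rcases hout' with h | h
        · exact (eventually_gt_nhds h).mono fun _ => .inl
        · exact .of_forall fun _ => .inr h
      filter_upwards [eventually_gt_nhds hVb', eventually_lt_nhds hVX', n3] with v a1 a2 a3
      exact hmax (a := (v, t)) ⟨ht0, htT, a1.le, a2.le, a3.imp le_of_lt le_of_lt⟩
  -- The tests make the operator applied to W nonpositive. But w and the corner function contribute
  -- 0, and subtracting ε times a strict supersolution makes it positive.
  have f3 : 1 / 2 * m.σ ^ 2 * V ^ 2 * (wVV V t - A * cVV - ε * gVV) ≤ 0 :=
    mul_nonpos_of_nonneg_of_nonpos (by positivity) f2.2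
  have f4 := mul_neg_of_pos_of_neg hε g4
  have f5 : (m.r - m.q) * V * (wV V t - A * cV V - ε * gV V) = 0 := by rw [f2.1, mul_zero]
  have f6 : A * (ct + 1 / 2 * m.σ ^ 2 * V ^ 2 * cVV + (m.r - m.q) * V * cV V) = 0 := by
    rw [c4, mul_zero]
  linarith

/-- The maximum principle on the domain, with an exceptional corner. -/
lemma nonpos_of_equation (hσ : 0 < m.σ) (hb : 0 < m.b) (hT : m.T₁ < m.T)
    {w wt wV wVV : ℝ → ℝ → ℝ}
    (hc : ContinuousOn (Function.uncurry w) m.closedDomain)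
    {C : ℝ} {n : ℕ} (hg : ∀ V t, (V, t) ∈ m.closedDomain → |w V t| ≤ C * (1 + V ^ n))
    (heq : ∀ V t, (V, t) ∈ m.domain →
      HasDerivWithinAt (fun s => w V s) (wt V t) (Ico 0 m.T₁) t ∧
      HasDerivAt (fun v => w v t) (wV V t) V ∧
      HasDerivAt (fun v => wV v t) (wVV V t) V ∧
      wt V t + 1 / 2 * m.σ ^ 2 * V ^ 2 * wVV V t + (m.r - m.q) * V * wV V t = 0)
    (hlat : ∀ t, 0 ≤ t → t < m.T₁ → w (m.barrier t) t = 0)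
    (hter : ∀ V, m.barrier m.T₁ < V → w V m.T₁ = 0)
    {V t : ℝ} (h : (V, t) ∈ m.domain) : w V t ≤ 0 := by
  have ht : t < m.T₁ := h.2.1
  set κ := Real.exp (-(1 + |m.drift|) ^ 2 / 2) / √(m.σ ^ 2 + 1) with hκ
  have hκ0 : 0 < κ := by positivity
  -- Y bounds V throughout the strip V ≤ V_b(t)e, so w ≤ Aκ there for the A chosen next.
  set Y := m.b * Real.exp (|m.a| * m.T) * Real.exp 1 with hY
  set A := |C| * (1 + Y ^ n) / κ with hA
  have hY0 : 0 < Y := by positivity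
  have hA0 : 0 ≤ A := by positivity
  have hAw : ∀ V t, (V, t) ∈ m.closedDomain → V ≤ m.barrier t * Real.exp 1 → w V t ≤ A * κ := by
    intro V t hz hV
    have hV0 : 0 ≤ V := (barrier_pos hb t).le.trans hz.2.2.1
    have hbar : m.barrier t ≤ m.b * Real.exp (|m.a| * m.T) := by
      unfold barrier
      have h0 : 0 ≤ t := hz.1
      have h1 : t ≤ m.T₁ := hz.2.1
      have h2 : -m.a * (m.T - t) ≤ |m.a| * m.T := by
        calc -m.a * (m.T - t) ≤ |m.a| * (m.T - t) := by
              have : 0 ≤ m.T - t := by linarith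
              gcongr
              exact neg_le_abs m.a
          _ ≤ _ := by gcongr; linarith
      gcongr
    have hVY : V ≤ Y := hV.trans (by rw [hY]; gcongr)
    calc w V t ≤ C * (1 + V ^ n) := (le_abs_self _).trans (hg V t hz)
      _ ≤ |C| * (1 + Y ^ n) := by gcongr; exact le_abs_self _
      _ = A * κ := by rw [hA]; field_simp
  -- Both small parameters of the comparison are set equal to ε, which then tends to 0.
  have key : ∀ ε : ℝ, 0 < ε → ε ≤ 1 → ε ^ 2 ≤ m.T₁ - t →
      w V t ≤ ε * (A * (1 / √(m.σ ^ 2 * (m.T₁ - t))) + m.growthBarrier n V t) := by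
    intro ε hε hε1 hε2
    have h1 := le_barriers hb hc hg heq hlat hter hA0 hε hε hε1 hAw h hε2
    have h2 := mul_le_mul_of_nonneg_left (cornerBarrier_le hσ hε.le ht V) hA0
    linarith
  have hlim : Tendsto (fun ε : ℝ => ε * (A * (1 / √(m.σ ^ 2 * (m.T₁ - t))) +
      m.growthBarrier n V t)) (𝓝[>] 0) (𝓝 0) := by
    have : Tendsto (fun ε : ℝ => ε * (A * (1 / √(m.σ ^ 2 * (m.T₁ - t))) +
      m.growthBarrier n V t)) (𝓝 0) (𝓝 (0 * (A * (1 / √(m.σ ^ 2 * (m.T₁ - t))) +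
      m.growthBarrier n V t))) := tendsto_id.mul_const _
    rw [zero_mul] at this
    exact this.mono_left nhdsWithin_le_nhds
  refine ge_of_tendsto hlim ?_
  have n1 : ∀ᶠ ε in 𝓝 (0 : ℝ), ε < 1 := eventually_lt_nhds one_pos
  have n2 : ∀ᶠ ε in 𝓝 (0 : ℝ), ε ^ 2 < m.T₁ - t := by
    have : ContinuousAt (fun ε : ℝ => ε ^ 2) 0 := by fun_prop
    exact this.eventually_lt_const (by simpa using ht)
  filter_upwards [self_mem_nhdsWithin, n1.filter_mono nhdsWithin_le_nhds,
    n2.filter_mono nhdsWithin_le_nhds] with ε a1 a2 a3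
  exact key ε a1 a2.le a3.le

lemma IsPutPrice.le {K : ℝ} (hσ : 0 < m.σ) (hb : 0 < m.b) (hT : m.T₁ < m.T)
    {P Q : ℝ → ℝ → ℝ} (hP : m.IsPutPrice K P) (hQ : m.IsPutPrice K Q)
    {V t : ℝ} (h : (V, t) ∈ m.domain) : P V t ≤ Q V t := by
  obtain ⟨Pt, PV, PVV, -, -, -, hPe⟩ := hP.equation
  obtain ⟨Qt, QV, QVV, -, -, -, hQe⟩ := hQ.equation
  obtain ⟨C, k, hPg⟩ := hP.growth
  obtain ⟨D, l, hQg⟩ := hQ.growth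
  set B := Real.exp (|m.r| * m.T₁) with hB
  have hBt : ∀ t, 0 ≤ t → t ≤ m.T₁ → Real.exp (-m.r * t) ≤ B := fun t h0 h1 => by
    rw [hB]
    gcongr
    exact neg_le_abs m.r
  have hcont : Continuous fun z : ℝ × ℝ => Real.exp (-m.r * z.2) := by fun_prop
  -- The factor e^{-rt} removes the zero-order term -rP.
  have key := nonpos_of_equation (m := m) hσ hb hT
    (w := fun V t => Real.exp (-m.r * t) * (P V t - Q V t))
    (wt := fun V t => Real.exp (-m.r * t) * (Pt V t - Qt V t) +
      (-m.r) * Real.exp (-m.r * t) * (P V t - Q V t))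
    (wV := fun V t => Real.exp (-m.r * t) * (PV V t - QV V t))
    (wVV := fun V t => Real.exp (-m.r * t) * (PVV V t - QVV V t))
    (C := B * (2 * |C| + 2 * |D|)) (n := k + l)
    (hcont.continuousOn.mul (hP.continuousOn.sub hQ.continuousOn)) ?_ ?_ ?_ ?_ h
  · have := (mul_nonpos_iff_pos_imp_nonpos.1 key).1 (Real.exp_pos _)
    linarith
  · intro V t hz
    have hV : 0 ≤ V := (barrier_pos hb t).le.trans hz.2.2.1
    have hpow : ∀ i j : ℕ, 1 + V ^ i ≤ 2 * (1 + V ^ (i + j)) := fun i j => by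
      rcases le_total V 1 with h | h
      · have := pow_le_one₀ hV h (n := i)
        have : 0 ≤ V ^ (i + j) := by positivity
        linarith
      · have := pow_le_pow_right₀ h (Nat.le_add_right i j)
        have : 0 ≤ V ^ (i + j) := by positivity
        linarith
    have h1 : |P V t| ≤ |C| * (2 * (1 + V ^ (k + l))) :=
      (hPg V t hz).trans (mul_le_mul (le_abs_self _) (hpow k l) (by positivity) (abs_nonneg _))
    have h2 : |Q V t| ≤ |D| * (2 * (1 + V ^ (k + l))) := by
      rw [add_comm k l]
      exact (hQg V t hz).trans
        (mul_le_mul (le_abs_self _) (hpow l k) (by positivity) (abs_nonneg _))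
    rw [abs_mul, abs_of_pos (Real.exp_pos _)]
    calc _ ≤ B * (|P V t| + |Q V t|) := by
          have := hBt t hz.1 hz.2.1
          gcongr
          exact abs_sub _ _
      _ ≤ B * (|C| * (2 * (1 + V ^ (k + l))) + |D| * (2 * (1 + V ^ (k + l)))) := by gcongr
      _ = _ := by ring
  · intro V t hz
    obtain ⟨p1, p2, p3, p4⟩ := hPe V t hz
    obtain ⟨q1, q2, q3, q4⟩ := hQe V t hz
    have he : HasDerivAt (fun s => Real.exp (-m.r * s)) (-m.r * Real.exp (-m.r * t)) t := by
      have := ((hasDerivAt_id t).const_mul (-m.r)).exp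
      refine this.congr_deriv ?_
      simp; ring
    refine ⟨?_, (p2.sub q2).const_mul _, (p3.sub q3).const_mul _, ?_⟩
    · refine (he.hasDerivWithinAt.mul (p1.sub q1)).congr_deriv ?_
      simp only [Pi.sub_apply]
      ring
    · linear_combination Real.exp (-m.r * t) * (p4 - q4)
  · intro t h0 h1
    simp [hP.boundary t h0 h1, hQ.boundary t h0 h1]
  · intro V hV
    simp [hP.terminal V hV, hQ.terminal V hV]

end Model

/-! ### The normal distribution function -/

lemma integrable_gauss : Integrable fun y : ℝ => Real.exp (-y ^ 2 / 2) := by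
  have := integrable_exp_neg_mul_sq (b := 1 / 2) (by norm_num)
  refine this.congr (.of_forall fun y => ?_)
  simp only; congr 1; ring

lemma integral_gauss : ∫ y : ℝ, Real.exp (-y ^ 2 / 2) = √(2 * Real.pi) := by
  have := integral_gaussian (1 / 2)
  rw [show Real.pi / (1 / 2) = 2 * Real.pi by ring] at this
  rw [← this]
  congr 1; ext y; congr 1; ring

lemma sqrt_two_pi_pos : 0 < √(2 * Real.pi) := Real.sqrt_pos.2 (by positivity)

lemma N_nonneg (x : ℝ) : 0 ≤ N x :=
  mul_nonneg (by positivity) (setIntegral_nonneg measurableSet_Iic fun _ _ => (Real.exp_pos _).le)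

lemma N_le_one (x : ℝ) : N x ≤ 1 := by
  have h : ∫ y in Iic x, Real.exp (-y ^ 2 / 2) ≤ √(2 * Real.pi) := by
    rw [← integral_gauss]
    exact setIntegral_le_integral integrable_gauss (.of_forall fun _ => (Real.exp_pos _).le)
  unfold N
  calc _ ≤ 1 / √(2 * Real.pi) * √(2 * Real.pi) := by gcongr
    _ = 1 := by have := sqrt_two_pi_pos.ne'; field_simp

/-- The standard normal density. -/
def gaussDensity (x : ℝ) : ℝ := 1 / √(2 * Real.pi) * Real.exp (-x ^ 2 / 2)

lemma gaussDensity_pos (x : ℝ) : 0 < gaussDensity x :=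
  mul_pos (one_div_pos.2 sqrt_two_pi_pos) (Real.exp_pos _)

lemma continuous_gaussDensity : Continuous gaussDensity := by unfold gaussDensity; fun_prop

lemma integrable_gaussDensity : Integrable gaussDensity := integrable_gauss.const_mul _

lemma integral_gaussDensity : ∫ x, gaussDensity x = 1 := by
  have : ∫ x, gaussDensity x = ∫ x, 1 / √(2 * Real.pi) * Real.exp (-x ^ 2 / 2) := rfl
  rw [this, integral_const_mul, integral_gauss]
  have := sqrt_two_pi_pos.ne'
  field_simp

lemma gaussDensity_le_one (x : ℝ) : gaussDensity x ≤ 1 := by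
  have h1 : Real.exp (-x ^ 2 / 2) ≤ 1 := Real.exp_le_one_iff.2 (by nlinarith [sq_nonneg x])
  have h2 : 1 ≤ √(2 * Real.pi) := by
    rw [Real.one_le_sqrt]; linarith [Real.pi_gt_three]
  unfold gaussDensity
  calc _ ≤ (1 : ℝ) / 1 * 1 := by gcongr
    _ = 1 := by norm_num

lemma N_eq_integral (x : ℝ) : N x = ∫ y in Iic x, gaussDensity y := by
  unfold N gaussDensity
  rw [integral_const_mul]

lemma hasDerivAt_N (x : ℝ) : HasDerivAt N (gaussDensity x) x := by
  have h : N = fun x => N 0 + ∫ y in (0 : ℝ)..x, gaussDensity y := by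
    ext x
    rw [← intervalIntegral.integral_Iic_sub_Iic integrable_gaussDensity.integrableOn
      integrable_gaussDensity.integrableOn, N_eq_integral, N_eq_integral]
    ring
  rw [h]
  exact (intervalIntegral.integral_hasDerivAt_right
    (continuous_gaussDensity.intervalIntegrable _ _)
    (continuous_gaussDensity.stronglyMeasurableAtFilter _ _)
    continuous_gaussDensity.continuousAt).const_add _

lemma continuous_N : Continuous N := continuous_iff_continuousAt.2 fun x => (hasDerivAt_N x).continuousAt

lemma tendsto_N_atTop : Tendsto N atTop (𝓝 1) := by
  have := (aecover_Iic (μ := volume) tendsto_id).integral_tendsto_of_countably_generated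
    integrable_gaussDensity
  rw [integral_gaussDensity] at this
  refine this.congr fun x => (N_eq_integral x).symm

/-- The Mills ratio bound: φ' = -xφ, and -x ≥ z on (-∞, -z], so integrating zφ ≤ φ' there gives it.
-/
lemma N_neg_mul_le (z : ℝ) : N (-z) * z ≤ gaussDensity z := by
  have hder : ∀ x ∈ Iic (-z), HasDerivAt gaussDensity (-x * gaussDensity x) x := fun x _ => by
    have := ((((hasDerivAt_id x).pow 2).neg.div_const 2).exp).const_mul (1 / √(2 * Real.pi))
    refine this.congr_deriv ?_
    simp [gaussDensity]; ring
  have hlim : Tendsto gaussDensity atBot (𝓝 0) := by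
    unfold gaussDensity
    have h1 : Tendsto (fun x : ℝ => -x ^ 2 / 2) atBot atBot := by
      have : Tendsto (fun x : ℝ => x ^ 2) atBot atTop :=
        (tendsto_pow_atTop two_ne_zero).comp tendsto_neg_atBot_atTop |>.congr fun x => by simp
      refine (tendsto_neg_atTop_atBot.comp (this.atTop_div_const two_pos)).congr fun x => ?_
      simp only [Function.comp_apply, neg_div]
    simpa using (Real.tendsto_exp_atBot.comp h1).const_mul (1 / √(2 * Real.pi))
  have hint : IntegrableOn (fun x => -x * gaussDensity x) (Iic (-z)) := by
    have h1 := integrable_mul_exp_neg_mul_sq (b := 1 / 2) (by norm_num)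
    have h2 := (h1.const_mul (-(1 / √(2 * Real.pi))))
    refine (h2.congr (.of_forall fun y => ?_)).integrableOn
    simp only [gaussDensity]
    rw [show -(1 / 2) * y ^ 2 = -y ^ 2 / 2 by ring]; ring
  have hFTC := integral_Iic_of_hasDerivAt_of_tendsto' hder hint hlim
  rw [sub_zero] at hFTC
  have hsymm : gaussDensity (-z) = gaussDensity z := by unfold gaussDensity; rw [neg_sq]
  rw [← hsymm, ← hFTC, N_eq_integral, ← integral_mul_const]
  refine setIntegral_mono_on (integrable_gaussDensity.integrableOn.mul_const z) hint
    measurableSet_Iic fun x hx => ?_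
  have : z ≤ -x := by have : x ≤ -z := hx; linarith
  nlinarith [gaussDensity_pos x]

/-! ### Survival probability of a Brownian motion with drift -/

/-- The probability that a Brownian motion with total variance `A ^ 2` and total drift `μ`, started
at `x`, stays positive. -/
def survivalProb (A μ x : ℝ) : ℝ :=
  N ((x + μ) / A) - Real.exp (-2 * μ / A ^ 2 * x) * N ((-x + μ) / A)

lemma survivalProb_zero (A μ : ℝ) : survivalProb A μ 0 = 0 := by simp [survivalProb]

/-- The reflection identity, from (x + μ)² - (μ - x)² = 4μx. It underlies both the image terms and
the monotonicity of the survival probability. -/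
lemma exp_mul_gaussDensity {A : ℝ} (hA : 0 < A) (μ x : ℝ) :
    Real.exp (-2 * μ / A ^ 2 * x) * gaussDensity ((-x + μ) / A) = gaussDensity ((x + μ) / A) := by
  unfold gaussDensity
  rw [mul_left_comm, ← Real.exp_add]
  congr 2
  field_simp
  ring

lemma hasDerivAt_survivalProb {A : ℝ} (hA : 0 < A) (μ x : ℝ) :
    HasDerivAt (survivalProb A μ) (2 / A * Real.exp (-2 * μ / A ^ 2 * x) *
      (gaussDensity ((-x + μ) / A) + μ / A * N ((-x + μ) / A))) x := by
  have h1 := (hasDerivAt_N ((x + μ) / A)).comp x (((hasDerivAt_id x).add_const μ).div_const A)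
  have h2 := (hasDerivAt_N ((-x + μ) / A)).comp x (((hasDerivAt_id x).neg.add_const μ).div_const A)
  have h3 := ((hasDerivAt_id x).const_mul (-2 * μ / A ^ 2)).exp
  refine (h1.sub (h3.mul h2)).congr_deriv ?_
  rw [← exp_mul_gaussDensity hA]
  simp
  field_simp
  ring

lemma continuous_survivalProb {A : ℝ} (hA : 0 < A) (μ : ℝ) : Continuous (survivalProb A μ) :=
  continuous_iff_continuousAt.2 fun x => (hasDerivAt_survivalProb hA μ x).continuousAt

/-- The sign of the derivative is that of φ + (μ/A)N at (μ - x)/A. Only μ < 0 needs an argument: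
there the Mills bound at z = (x - μ)/A > -μ/A suffices. -/
lemma strictMonoOn_survivalProb {A : ℝ} (hA : 0 < A) (μ : ℝ) :
    StrictMonoOn (survivalProb A μ) (Ici 0) := by
  refine strictMonoOn_of_deriv_pos (convex_Ici 0) (continuous_survivalProb hA μ).continuousOn ?_
  intro x hx
  rw [interior_Ici] at hx
  have hx0 : 0 < x := hx
  rw [(hasDerivAt_survivalProb hA μ x).deriv]
  refine mul_pos (mul_pos (by positivity) (Real.exp_pos _)) ?_
  have hg := gaussDensity_pos ((-x + μ) / A)
  have hN := N_nonneg ((-x + μ) / A)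
  rcases le_or_gt 0 μ with h | h
  · have : 0 ≤ μ / A := by positivity
    nlinarith [mul_nonneg this hN]
  · have hz : 0 < (x - μ) / A := div_pos (by linarith) hA
    have hM := N_neg_mul_le ((x - μ) / A)
    have e : -((x - μ) / A) = (-x + μ) / A := by ring
    have e2 : gaussDensity ((x - μ) / A) = gaussDensity ((-x + μ) / A) := by
      rw [← e]; unfold gaussDensity; rw [neg_sq]
    rw [e, e2] at hM
    have hd : (x - μ) / A = x / A - μ / A := sub_div _ _ _
    have hxA : 0 < x / A := div_pos hx0 hA
    rcases hN.eq_or_lt with h0 | h0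
    · rw [← h0]; linarith
    · rw [hd] at hM
      nlinarith [mul_pos h0 hxA]

/-- For μ < 0 the exponential grows, but the Mills bound and the reflection identity turn the image
term into at most 1/z with z = (x - μ)/A. -/
lemma tendsto_survivalProb {A : ℝ} (hA : 0 < A) (μ : ℝ) :
    Tendsto (survivalProb A μ) atTop (𝓝 1) := by
  have h1 : Tendsto (fun x => N ((x + μ) / A)) atTop (𝓝 1) :=
    tendsto_N_atTop.comp ((tendsto_atTop_add_const_right _ μ tendsto_id).atTop_div_const hA)
  have h2 : Tendsto (fun x => Real.exp (-2 * μ / A ^ 2 * x) * N ((-x + μ) / A)) atTop (𝓝 0) := by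
    have hz : Tendsto (fun x => (x - μ) / A) atTop atTop :=
      (tendsto_atTop_add_const_right _ (-μ) tendsto_id).atTop_div_const hA
    refine squeeze_zero' (.of_forall fun x => mul_nonneg (Real.exp_pos _).le (N_nonneg _)) ?_
      hz.inv_tendsto_atTop
    filter_upwards [hz.eventually_gt_atTop 0] with x hx
    have hM := N_neg_mul_le ((x - μ) / A)
    have e : -((x - μ) / A) = (-x + μ) / A := by ring
    have e2 : gaussDensity ((x - μ) / A) = gaussDensity ((-x + μ) / A) := by
      rw [← e]; unfold gaussDensity; rw [neg_sq]
    rw [e, e2] at hM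
    rw [Pi.inv_apply, ← one_div, le_div_iff₀ hx, mul_assoc]
    calc _ ≤ Real.exp (-2 * μ / A ^ 2 * x) * gaussDensity ((-x + μ) / A) := by gcongr
      _ ≤ 1 := by rw [exp_mul_gaussDensity hA]; exact gaussDensity_le_one _
  have := h1.sub h2
  rw [sub_zero] at this
  exact this

lemma exists_survivalProb_eq {A : ℝ} (hA : 0 < A) (μ : ℝ) {θ : ℝ} (h0 : 0 < θ) (h1 : θ < 1) :
    ∃ k, 0 < k ∧ survivalProb A μ k = θ := by
  obtain ⟨x, hx, hx0⟩ := (((tendsto_survivalProb hA μ).eventually_const_lt h1).and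
    (eventually_ge_atTop 0)).exists
  obtain ⟨k, hk, hkθ⟩ := intermediate_value_Icc hx0 (continuous_survivalProb hA μ).continuousOn
    (show θ ∈ Icc (survivalProb A μ 0) (survivalProb A μ x) by
      rw [survivalProb_zero]; exact ⟨h0.le, hx.le⟩)
  refine ⟨k, lt_of_le_of_ne hk.1 ?_, hkθ⟩
  rintro rfl
  rw [survivalProb_zero] at hkθ
  exact h0.ne hkθ

/-! ### The bivariate normal distribution as a Gaussian integral of N -/

lemma integral_comp_affine (g : ℝ → ℝ) (a : ℝ) {κ : ℝ} (hκ : 0 < κ) :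
    ∫ y, g ((y - a) / κ) = κ * ∫ y, g y := by
  rw [integral_sub_right_eq_self (fun y => g (y / κ)) a, Measure.integral_comp_div, smul_eq_mul,
    abs_of_pos hκ]

lemma setIntegral_Iic_comp_affine (g : ℝ → ℝ) (a b : ℝ) {κ : ℝ} (hκ : 0 < κ) :
    ∫ y in Iic b, g ((y - a) / κ) = κ * ∫ y in Iic ((b - a) / κ), g y := by
  rw [← integral_indicator measurableSet_Iic, ← integral_indicator measurableSet_Iic,
    ← integral_comp_affine _ a hκ]
  congr 1; ext y
  simp only [indicator, mem_Iic]
  congr 1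
  rw [div_le_div_iff_of_pos_right hκ, sub_le_sub_iff_right]

lemma integrable_bivariate {ρ : ℝ} (hρ : ρ ^ 2 < 1) :
    Integrable (fun z : ℝ × ℝ =>
      Real.exp (-(z.1 ^ 2 - 2 * ρ * z.1 * z.2 + z.2 ^ 2) / (2 * (1 - ρ ^ 2)))) := by
  have hρ' : |ρ| < 1 := (sq_lt_one_iff_abs_lt_one ρ).1 hρ
  have hp : 0 < 1 - ρ ^ 2 := by linarith
  set c := (1 - |ρ|) / (2 * (1 - ρ ^ 2)) with hc
  have hc0 : 0 < c := div_pos (by linarith) (by positivity)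
  have h1 := (integrable_exp_neg_mul_sq hc0).mul_prod (integrable_exp_neg_mul_sq hc0)
  refine Integrable.mono' h1 (Continuous.aestronglyMeasurable (by fun_prop)) (.of_forall fun z => ?_)
  rw [Real.norm_of_nonneg (Real.exp_pos _).le, ← Real.exp_add]
  apply Real.exp_le_exp.2
  have : -c * z.1 ^ 2 + -c * z.2 ^ 2 =
      -((1 - |ρ|) * (z.1 ^ 2 + z.2 ^ 2)) / (2 * (1 - ρ ^ 2)) := by rw [hc]; ring
  rw [this]
  gcongr
  have h2 : ρ * (z.1 * z.2) ≤ |ρ| * |z.1 * z.2| := by rw [← abs_mul]; exact le_abs_self _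
  have h3 : 2 * |z.1 * z.2| ≤ z.1 ^ 2 + z.2 ^ 2 := by
    rw [abs_mul, ← sq_abs z.1, ← sq_abs z.2]
    nlinarith [sq_nonneg (|z.1| - |z.2|)]
  have h4 := mul_le_mul_of_nonneg_left h3 (abs_nonneg ρ)
  nlinarith

/-- Conditioning on the second variable: given z, the first is normal with mean ρz and variance 1 -
ρ². -/
lemma N₂_eq_integral {ρ : ℝ} (hρ : ρ ^ 2 < 1) (a₁ a₂ : ℝ) :
    N₂ a₁ a₂ ρ = ∫ z in Iic a₂, gaussDensity z * N ((a₁ - ρ * z) / √(1 - ρ ^ 2)) := by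
  have hp : 0 < 1 - ρ ^ 2 := by linarith
  have hs : 0 < √(1 - ρ ^ 2) := Real.sqrt_pos.2 hp
  have hss : √(1 - ρ ^ 2) ^ 2 = 1 - ρ ^ 2 := Real.sq_sqrt hp.le
  unfold N₂
  rw [integral_integral_swap, ← integral_const_mul]
  · congr 1; ext z
    have : ∀ y : ℝ, Real.exp (-(y ^ 2 - 2 * ρ * y * z + z ^ 2) / (2 * (1 - ρ ^ 2))) =
        Real.exp (-z ^ 2 / 2) * Real.exp (-((y - ρ * z) / √(1 - ρ ^ 2)) ^ 2 / 2) := by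
      intro y
      rw [← Real.exp_add, div_pow, hss]
      congr 1
      field_simp
      ring
    simp only [this]
    rw [integral_const_mul,
      setIntegral_Iic_comp_affine (fun w => Real.exp (-w ^ 2 / 2)) (ρ * z) a₁ hs]
    unfold N gaussDensity
    have h2 : √(2 * Real.pi) * √(2 * Real.pi) = 2 * Real.pi :=
      Real.mul_self_sqrt (by positivity)
    have h3 := sqrt_two_pi_pos
    generalize √(2 * Real.pi) = w at h2 h3 ⊢
    rw [← h2]
    field_simp
  · rw [Measure.prod_restrict]
    exact (integrable_bivariate hρ).integrableOn

lemma integrable_gaussDensity_mul_N (A B : ℝ) :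
    Integrable fun z => gaussDensity z * N (A + B * z) := by
  have hc := continuous_N
  have hg := continuous_gaussDensity
  refine integrable_gaussDensity.mono' (Continuous.aestronglyMeasurable (by fun_prop))
    (.of_forall fun z => ?_)
  rw [norm_mul, Real.norm_of_nonneg (gaussDensity_pos z).le, Real.norm_of_nonneg (N_nonneg _)]
  exact mul_le_of_le_one_right (gaussDensity_pos z).le (N_le_one _)

/-- The substitution y = μ - cz reduces this to `N₂_eq_integral`; `h` matches the affine argument of
N with the conditional one. -/
lemma integral_gauss_mul_N {c ρ : ℝ} (hc : 0 < c) (hρ : ρ ^ 2 < 1) {d A B μ : ℝ}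
    (h : ∀ z, (d - ρ * z) / √(1 - ρ ^ 2) = A + B * (μ - c * z)) (k : ℝ) :
    ∫ y in (0 : ℝ)..k, gaussDensity ((μ - y) / c) / c * N (A + B * y) =
      N₂ d (μ / c) ρ - N₂ d ((μ - k) / c) ρ := by
  rw [N₂_eq_integral hρ, N₂_eq_integral hρ]
  simp only [h]
  have hint : Integrable fun z => gaussDensity z * N (A + B * (μ - c * z)) := by
    refine (integrable_gaussDensity_mul_N (A + B * μ) (-B * c)).congr (.of_forall fun z => ?_)
    simp only; congr 2; ring
  rw [intervalIntegral.integral_Iic_sub_Iic hint.integrableOn hint.integrableOn]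
  have := intervalIntegral.integral_comp_sub_mul (a := (μ - k) / c) (b := μ / c)
    (fun y => gaussDensity ((μ - y) / c) * N (A + B * y)) hc.ne' μ
  have e1 : μ - c * (μ / c) = 0 := by field_simp; ring
  have e2 : μ - c * ((μ - k) / c) = k := by field_simp; ring
  rw [e1, e2] at this
  have e3 : ∀ z, (μ - (μ - c * z)) / c = z := fun z => by field_simp; ring
  simp only [e3] at this
  rw [this, smul_eq_mul, ← intervalIntegral.integral_const_mul]
  congr 1; ext y; ring

lemma integral_gauss_eq_N {c : ℝ} (hc : 0 < c) (μ k : ℝ) :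
    ∫ y in (0 : ℝ)..k, gaussDensity ((μ - y) / c) / c = N (μ / c) - N ((μ - k) / c) := by
  rw [N_eq_integral, N_eq_integral,
    intervalIntegral.integral_Iic_sub_Iic integrable_gaussDensity.integrableOn
      integrable_gaussDensity.integrableOn]
  have := intervalIntegral.integral_comp_sub_mul (a := (μ - k) / c) (b := μ / c)
    (fun y => gaussDensity ((μ - y) / c)) hc.ne' μ
  have e1 : μ - c * (μ / c) = 0 := by field_simp; ring
  have e2 : μ - c * ((μ - k) / c) = k := by field_simp; ring
  rw [e1, e2] at this
  have e3 : ∀ z, (μ - (μ - c * z)) / c = z := fun z => by field_simp; ring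
  simp only [e3] at this
  rw [this, smul_eq_mul, ← intervalIntegral.integral_const_mul]
  congr 1; ext y; ring

/-! ### The early redemption boundary and the payoff -/

namespace Model

variable {m : Model}

lemma power_eq (hσ : 0 < m.σ) : m.power = -2 * m.drift / m.σ ^ 2 := by
  unfold power drift; field_simp; ring

/-- The reflection exponent -2μ/A² is the same for every time span s, so one weight serves the bond
and the option at all times. -/
lemma power_eq' (hσ : 0 < m.σ) {s : ℝ} (hs : 0 < s) :
    m.power = -2 * (m.drift * s) / (m.σ * √s) ^ 2 := by
  rw [power_eq hσ, mul_pow, Real.sq_sqrt hs.le]; field_simp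

lemma rpow_power (hb : 0 < m.b) {V : ℝ} (hV : 0 < V) (t : ℝ) :
    (V / m.barrier t) ^ m.power = Real.exp (m.power * Real.log (V / m.barrier t)) := by
  rw [Real.rpow_def_of_pos (div_pos hV (barrier_pos hb t)), mul_comm]

lemma log_barrier_div (V t : ℝ) :
    Real.log (m.barrier t / V) = -Real.log (V / m.barrier t) := by
  rw [← Real.log_inv, inv_div]

lemma survival_eq (hσ : 0 < m.σ) (hb : 0 < m.b) {V t : ℝ} (hV : 0 < V) (ht : t < m.T) :
    m.survival V t = survivalProb (m.σ * √(m.T - t)) (m.drift * (m.T - t))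
      (Real.log (V / m.barrier t)) := by
  unfold survival survivalProb d₁ d₂
  rw [rpow_power hb hV, log_barrier_div, power_eq' hσ (sub_pos.2 ht)]

variable (m) in
/-- The critical survival probability. -/
def criticalProb : ℝ :=
  (m.E - m.R * Real.exp (-m.r * (m.T - m.T₁))) / ((1 - m.R) * Real.exp (-m.r * (m.T - m.T₁)))

variable (m) in
/-- The survival probability at time `T₁` in logarithmic distance to the barrier. -/
def logSurvival (x : ℝ) : ℝ :=
  survivalProb (m.σ * √(m.T - m.T₁)) (m.drift * (m.T - m.T₁)) x

lemma bondPrice_lt_iff (hσ : 0 < m.σ) (hb : 0 < m.b) (hR₁ : m.R < 1) (hT : m.T₁ < m.T) {V : ℝ}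
    (hV : 0 < V) : m.bondPrice V m.T₁ < m.E ↔
      m.logSurvival (Real.log (V / m.barrier m.T₁)) < m.criticalProb := by
  have h : 0 < 1 - m.R := by linarith
  have := Real.exp_pos (-m.r * (m.T - m.T₁))
  unfold bondPrice criticalProb logSurvival
  rw [survival_eq hσ hb hV hT, lt_div_iff₀ (by positivity), lt_sub_iff_add_lt']
  ring_nf

lemma exists_logBoundary (hσ : 0 < m.σ) (hb : 0 < m.b) (hR₁ : m.R < 1) (hT : m.T₁ < m.T)
    (hE₁ : Real.exp (-m.r * (m.T - m.T₁)) * m.R < m.E)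
    (hE₂ : m.E < Real.exp (-m.r * (m.T - m.T₁))) :
    ∃ k, 0 < k ∧ m.logSurvival k = m.criticalProb ∧
      ∀ K, m.IsRedemptionBoundary K ↔ K = m.barrier m.T₁ * Real.exp k := by
  have h : 0 < 1 - m.R := by linarith
  have he := Real.exp_pos (-m.r * (m.T - m.T₁))
  have hA : 0 < m.σ * √(m.T - m.T₁) := mul_pos hσ (Real.sqrt_pos.2 (sub_pos.2 hT))
  have hB := barrier_pos hb m.T₁
  obtain ⟨k, hk, hkθ⟩ := exists_survivalProb_eq hA (m.drift * (m.T - m.T₁))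
    (θ := m.criticalProb) (div_pos (by linarith) (by positivity))
    (by unfold criticalProb; rw [div_lt_one (by positivity)]; linarith)
  have hbd : m.IsRedemptionBoundary (m.barrier m.T₁ * Real.exp k) := by
    refine ⟨le_mul_of_one_le_right hB.le (Real.one_le_exp hk.le), fun V hV => ?_⟩
    have hV0 : 0 < V := hB.trans hV
    have key : m.bondPrice V m.T₁ < m.E ↔ V < m.barrier m.T₁ * Real.exp k := by
      rw [bondPrice_lt_iff hσ hb hR₁ hT hV0, ← hkθ, logSurvival,
        (strictMonoOn_survivalProb hA _).lt_iff_lt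
          (Real.log_nonneg ((one_le_div hB).2 hV.le)) hk.le,
        Real.log_lt_iff_lt_exp (div_pos hV0 hB), div_lt_iff₀ hB, mul_comm]
    exact ⟨key.2, fun hKV => not_lt.1 fun h => not_lt.2 hKV (key.1 h)⟩
  refine ⟨k, hk, hkθ, fun K => ⟨fun hK => ?_, fun hK => hK ▸ hbd⟩⟩
  -- A value strictly between two boundaries would be classified in opposite ways by them.
  have aux : ∀ K₁ K₂, m.IsRedemptionBoundary K₁ → m.IsRedemptionBoundary K₂ → ¬ K₁ < K₂ := by
    intro K₁ K₂ h₁ h₂ hlt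
    obtain ⟨V, hV1, hV2⟩ := exists_between hlt
    have hV := h₁.1.trans_lt hV1
    exact absurd ((h₂.2 V hV).1 hV2) (not_lt.2 ((h₁.2 V hV).2 hV1.le))
  exact le_antisymm (not_lt.1 (aux _ _ hbd hK)) (not_lt.1 (aux _ _ hK hbd))

lemma payoff_eq_terminalValue {K : ℝ} (hK : m.IsRedemptionBoundary K) {V : ℝ}
    (hV : m.barrier m.T₁ < V) : max (m.E - m.bondPrice V m.T₁) 0 = m.terminalValue K V := by
  unfold terminalValue
  by_cases h : V < K
  · have h1 := (hK.2 V hV).1 h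
    rw [max_eq_left (by linarith), indicator_of_mem (show V ∈ Iio K from h)]
    unfold bondPrice survival
    simp
    ring
  · have h1 := (hK.2 V hV).2 (not_lt.1 h)
    rw [max_eq_right (by linarith), indicator_of_notMem (show V ∉ Iio K from h)]
    simp

end Model

/-! ### The image extension and its Gaussian mean -/

/-- The extension of `g`, restricted to `(0, k)`, whose Gaussian convolutions vanish on the
barrier. -/
def oddExt (g : ℝ → ℝ) (β k y : ℝ) : ℝ :=
  if 0 < y then g (min y k) else if y < 0 then -(Real.exp (β * y) * g (min (-y) k)) else 0

section oddExt

variable {g : ℝ → ℝ} {β k : ℝ}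

lemma measurable_oddExt (hg : Continuous g) : Measurable (oddExt g β k) := by
  unfold oddExt
  refine Measurable.ite measurableSet_Ioi (by fun_prop) (Measurable.ite measurableSet_Iio ?_ ?_)
  · exact Continuous.measurable (by fun_prop)
  · exact measurable_const

/-- `min y k` freezes the argument at k, where g vanishes: truncation at k without a jump. -/
lemma oddExt_of_notMem (hgk : g k = 0) {y : ℝ} (hy : y ∉ Icc (-k) k) : oddExt g β k y = 0 := by
  rw [mem_Icc, not_and_or, not_le, not_le] at hy
  unfold oddExt
  split_ifs with h1 h2
  · rcases hy with h | h
    · rw [min_eq_right (by linarith), hgk]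
    · rw [min_eq_right h.le, hgk]
  · rcases hy with h | h
    · rw [min_eq_right (by linarith), hgk]; simp
    · rw [min_eq_right (by linarith), hgk]; simp
  · rfl

lemma exists_bound_oddExt (hg : Continuous g) (hk : 0 < k) (hgk : g k = 0) :
    ∃ C, ∀ y, |oddExt g β k y| ≤ C := by
  obtain ⟨C, hC⟩ := isCompact_Icc.exists_bound_of_continuousOn (s := Icc 0 k) hg.continuousOn
  have hC0 : 0 ≤ C := (norm_nonneg _).trans (hC 0 ⟨le_rfl, hk.le⟩)
  refine ⟨Real.exp (|β| * k) * C, fun y => ?_⟩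
  have h1 : 1 ≤ Real.exp (|β| * k) := Real.one_le_exp (by positivity)
  by_cases hy : y ∈ Icc (-k) k
  · unfold oddExt
    split_ifs with h h'
    · have := hC (min y k) ⟨le_min h.le hk.le, min_le_right _ _⟩
      rw [Real.norm_eq_abs] at this
      nlinarith
    · have := hC (min (-y) k) ⟨le_min (by linarith) hk.le, min_le_right _ _⟩
      rw [abs_neg, abs_mul, abs_of_pos (Real.exp_pos _)]
      have h2 : β * y ≤ |β| * k := by
        calc β * y ≤ |β| * |y| := by rw [← abs_mul]; exact le_abs_self _
          _ ≤ _ := by gcongr; exact abs_le.2 hy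
      gcongr
      exact this
    · rw [abs_zero]; positivity
  · rw [oddExt_of_notMem hgk hy, abs_zero]; positivity

/-- The point k is included. A jump can remain only at the images' meeting point 0 and, for positive
x, nowhere; the jump at 0 corresponds to the exceptional corner. -/
lemma continuousAt_oddExt (hg : Continuous g) {x : ℝ} (hx : 0 < x) :
    ContinuousAt (oddExt g β k) x := by
  have h : ContinuousAt (fun y => g (min y k)) x := by fun_prop
  refine h.congr ?_
  filter_upwards [eventually_gt_nhds hx] with y hy
  simp [oddExt, hy]

end oddExt

/-- The expectation of `F` under the normal law with mean `p.1` and variance `p.2`. -/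
def gaussMean (F : ℝ → ℝ) (p : ℝ × ℝ) : ℝ := ∫ z, gaussDensity z * F (p.1 + √p.2 * z)

section gaussMean

variable {F : ℝ → ℝ} {C : ℝ}

lemma gaussMean_zero (c : ℝ) : gaussMean F (c, 0) = F c := by
  simp [gaussMean, integral_mul_const, integral_gaussDensity]

lemma abs_gaussMean_le (hC : ∀ y, |F y| ≤ C) (p : ℝ × ℝ) : |gaussMean F p| ≤ C := by
  have := norm_integral_le_of_norm_le (integrable_gaussDensity.mul_const C)
    (f := fun z => gaussDensity z * F (p.1 + √p.2 * z)) (.of_forall fun z => by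
      rw [norm_mul, Real.norm_of_nonneg (gaussDensity_pos z).le]
      exact mul_le_mul_of_nonneg_left (hC _) (gaussDensity_pos z).le)
  rwa [integral_mul_const, integral_gaussDensity, one_mul] at this

/-- The variance enters only through √p.2, so dominated convergence works down to variance 0. As the
square root is 0 on negative numbers, a full neighbourhood can be used. -/
lemma continuousAt_gaussMean (hF : Measurable F) (hC : ∀ y, |F y| ≤ C) {c : ℝ}
    (hc : ContinuousAt F c) : ContinuousAt (gaussMean F) (c, 0) := by
  have hg := continuous_gaussDensity.measurable
  refine tendsto_integral_filter_of_dominated_convergence (fun z => gaussDensity z * C)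
    (.of_forall fun p => Measurable.aestronglyMeasurable (by fun_prop)) (.of_forall fun p => ?_)
    (integrable_gaussDensity.mul_const C) (.of_forall fun z => ?_)
  · refine .of_forall fun z => ?_
    rw [norm_mul, Real.norm_of_nonneg (gaussDensity_pos z).le]
    exact mul_le_mul_of_nonneg_left (hC _) (gaussDensity_pos z).le
  · have h1 : ContinuousAt (fun p : ℝ × ℝ => p.1 + √p.2 * z) (c, 0) := by fun_prop
    have h2 : ContinuousAt (fun p : ℝ × ℝ => F (p.1 + √p.2 * z)) (c, 0) := by
      refine ContinuousAt.comp (g := F) ?_ h1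
      simpa using hc
    exact h2.const_mul _

lemma gaussMean_eq (F : ℝ → ℝ) (c : ℝ) {A : ℝ} (hA : 0 < A) :
    gaussMean F (c, A ^ 2) = ∫ y, gaussDensity ((c - y) / A) / A * F y := by
  have h := integral_comp_affine (fun z => gaussDensity z * F (c + A * z)) c hA
  unfold gaussMean
  simp only [Real.sqrt_sq hA.le]
  rw [eq_comm, ← mul_right_inj' hA.ne', ← h, ← integral_const_mul]
  congr 1; ext y
  have e1 : c + A * ((y - c) / A) = y := by field_simp; ring
  have e2 : gaussDensity ((y - c) / A) = gaussDensity ((c - y) / A) := by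
    rw [← neg_sub, neg_div]; unfold gaussDensity; rw [neg_sq]
  rw [e1, e2]
  field_simp

lemma gaussMean_eq_moment {L : ℝ} (hL : ∀ y ∉ Icc (-L) L, F y = 0) (c : ℝ) {S : ℝ} (hS : 0 < S) :
    gaussMean F (c, S) =
      1 / √(2 * Real.pi) * (gaussFactor (c, S) * moment L F (c / S, 1 / (2 * S))) := by
  have hs : 0 < √S := Real.sqrt_pos.2 hS
  have hss : √S ^ 2 = S := Real.sq_sqrt hS.le
  conv_lhs => rw [← hss]
  rw [gaussMean_eq F c hs, moment, setIntegral_eq_integral_of_forall_compl_eq_zero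
    fun y hy => by rw [hL y hy, mul_zero], ← integral_const_mul, ← integral_const_mul]
  congr 1; ext y
  have : Real.exp (-((c - y) / √S) ^ 2 / 2) =
      Real.exp (-c ^ 2 / (2 * S)) * Real.exp (c / S * y - 1 / (2 * S) * y ^ 2) := by
    rw [← Real.exp_add, div_pow, hss]
    congr 1
    field_simp
    ring
  rw [gaussDensity, gaussFactor, this]
  ring

end gaussMean

/-- Substituting y ↦ -y on the negative half and applying the reflection identity at x + y gives the
image term. At x = 0 the two integrals coincide and cancel. -/
lemma gaussMean_oddExt {g : ℝ → ℝ} (hg : Continuous g) {k : ℝ} (hk : 0 < k) (hgk : g k = 0)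
    {A : ℝ} (hA : 0 < A) (μ x : ℝ) :
    gaussMean (oddExt g (-2 * μ / A ^ 2) k) (x + μ, A ^ 2) =
      (∫ y in (0 : ℝ)..k, gaussDensity ((x + μ - y) / A) / A * g y) -
        Real.exp (-2 * μ / A ^ 2 * x) *
          ∫ y in (0 : ℝ)..k, gaussDensity ((-x + μ - y) / A) / A * g y := by
  set β := -2 * μ / A ^ 2 with hβ
  set f : ℝ → ℝ := fun y => gaussDensity ((x + μ - y) / A) / A * oddExt g β k y with hf
  obtain ⟨C, hC⟩ := exists_bound_oddExt (β := β) hg hk hgk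
  have hgd := continuous_gaussDensity
  have hm := measurable_oddExt (β := β) (k := k) hg
  have hi : Integrable f := by
    have h1 : Integrable fun y => gaussDensity ((x + μ - y) / A) / A :=
      (((integrable_gaussDensity.comp_div hA.ne').comp_sub_left (x + μ))).div_const A
    refine h1.mul_bdd (c := C) hm.aestronglyMeasurable (.of_forall fun y => hC y)
  have h1 : ∫ y, f y = ∫ y in (-k)..k, f y := by
    rw [intervalIntegral.integral_of_le (by linarith), ← integral_Icc_eq_integral_Ioc,
      setIntegral_eq_integral_of_forall_compl_eq_zero]
    intro y hy
    rw [hf]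
    simp only
    rw [oddExt_of_notMem hgk hy, mul_zero]
  have h2 : ∫ y in (0 : ℝ)..k, f y =
      ∫ y in (0 : ℝ)..k, gaussDensity ((x + μ - y) / A) / A * g y := by
    refine intervalIntegral.integral_congr_ae (.of_forall fun y hy => ?_)
    rw [uIoc_of_le hk.le] at hy
    simp only [hf, oddExt, if_pos hy.1, min_eq_left hy.2]
  have h3 : ∫ y in (-k)..0, f y = -(Real.exp (β * x) *
      ∫ y in (0 : ℝ)..k, gaussDensity ((-x + μ - y) / A) / A * g y) := by
    have := intervalIntegral.integral_comp_neg (a := 0) (b := k) f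
    rw [neg_zero] at this
    rw [← this, ← intervalIntegral.integral_const_mul, ← intervalIntegral.integral_neg]
    refine intervalIntegral.integral_congr_ae (.of_forall fun y hy => ?_)
    rw [uIoc_of_le hk.le] at hy
    have hy0 : 0 < y := hy.1
    have e1 : ¬ 0 < -y := by linarith
    have e2 : -y < 0 := by linarith
    simp only [hf, oddExt, if_neg e1, if_pos e2, neg_neg, min_eq_left hy.2]
    have e3 := exp_mul_gaussDensity hA μ (x + y)
    rw [← hβ, mul_add, Real.exp_add] at e3
    have e4 : x + μ - -y = x + y + μ := by ring
    have e5 : -x + μ - y = -(x + y) + μ := by ring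
    have e6 : Real.exp (β * y) * Real.exp (β * -y) = 1 := by rw [← Real.exp_add]; simp
    rw [e4, e5, ← e3]
    linear_combination (-(Real.exp (β * x) * gaussDensity ((-(x + y) + μ) / A) / A * g y)) * e6
  rw [gaussMean_eq _ _ hA, h1, ← intervalIntegral.integral_add_adjacent_intervals (b := 0)
    hi.intervalIntegrable hi.intervalIntegrable, h2, h3]
  ring

/-! ### Closed form of the payoff integrals -/

/-- The Gaussian mean over `(0, k)` of an affine function of the survival probability, in terms
of the bivariate normal distribution. -/
lemma integral_gauss_mul_survivalProb {σ ν s τ : ℝ} (hσ : 0 < σ) (hs : 0 < s) (hτ : 0 < τ)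
    (c₀ c₁ x k : ℝ) :
    ∫ y in (0 : ℝ)..k, gaussDensity ((x + ν * τ - y) / (σ * √τ)) / (σ * √τ) *
        (c₀ - c₁ * survivalProb (σ * √s) (ν * s) y) =
      c₀ * (N ((x + ν * τ) / (σ * √τ)) - N ((x + ν * τ - k) / (σ * √τ))) -
      c₁ * (N₂ ((x + ν * (s + τ)) / (σ * √(s + τ))) ((x + ν * τ) / (σ * √τ)) √(τ / (s + τ)) -
        N₂ ((x + ν * (s + τ)) / (σ * √(s + τ))) ((x + ν * τ - k) / (σ * √τ)) √(τ / (s + τ))) +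
      c₁ * (Real.exp (-2 * ν / σ ^ 2 * x) *
        (N₂ ((-x + ν * (s + τ)) / (σ * √(s + τ))) ((x - ν * τ) / (σ * √τ)) (-√(τ / (s + τ))) -
        N₂ ((-x + ν * (s + τ)) / (σ * √(s + τ))) ((x - ν * τ - k) / (σ * √τ))
          (-√(τ / (s + τ))))) := by
  have hs' : 0 < √s := Real.sqrt_pos.2 hs
  have hτ' : 0 < √τ := Real.sqrt_pos.2 hτ
  have hsτ' : 0 < √(s + τ) := Real.sqrt_pos.2 (by positivity)
  have hss : √s ^ 2 = s := Real.sq_sqrt hs.le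
  have hττ : √τ ^ 2 = τ := Real.sq_sqrt hτ.le
  have hstt : √(s + τ) ^ 2 = s + τ := Real.sq_sqrt (by positivity)
  have hA : 0 < σ * √τ := by positivity
  have hρe : √(τ / (s + τ)) = √τ / √(s + τ) := Real.sqrt_div hτ.le _
  have hρ2 : √(τ / (s + τ)) ^ 2 = τ / (s + τ) := Real.sq_sqrt (by positivity)
  have hρ : √(τ / (s + τ)) ^ 2 < 1 := by
    rw [hρ2, div_lt_one (by positivity)]; linarith
  have hρ' : √(1 - √(τ / (s + τ)) ^ 2) = √s / √(s + τ) := by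
    rw [hρ2, ← Real.sqrt_div hs.le]
    congr 1
    field_simp
    ring
  have hβτ : -2 * (ν * τ) / (σ * √τ) ^ 2 = -2 * ν / σ ^ 2 := by
    rw [mul_pow, hττ]; field_simp
  have hβs : -2 * (ν * s) / (σ * √s) ^ 2 = -2 * ν / σ ^ 2 := by
    rw [mul_pow, hss]; field_simp
  have i1 := integral_gauss_eq_N hA (x + ν * τ) k
  have i2 := integral_gauss_mul_N (c := σ * √τ) hA hρ
    (d := (x + ν * (s + τ)) / (σ * √(s + τ))) (A := ν * s / (σ * √s)) (B := 1 / (σ * √s))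
    (μ := x + ν * τ) (fun z => by rw [hρ', hρe]; field_simp; ring) k
  -- The image term of the survival probability carries e^{βy}; multiplied by the Gaussian density
  -- it moves the mean from x + ντ to x - ντ and leaves e^{βx}. The slope of N in y changes sign,
  -- hence the correlation -ρ.
  have i3 := integral_gauss_mul_N (c := σ * √τ) (ρ := -√(τ / (s + τ))) hA (by rw [neg_sq]; exact hρ)
    (d := (-x + ν * (s + τ)) / (σ * √(s + τ))) (A := ν * s / (σ * √s)) (B := -1 / (σ * √s))
    (μ := x - ν * τ) (fun z => by rw [neg_sq, hρ', hρe]; field_simp; ring) k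
  rw [← i1, ← i2, ← i3]
  have hgd := continuous_gaussDensity
  have hN := continuous_N
  simp only [← intervalIntegral.integral_const_mul]
  rw [← intervalIntegral.integral_sub, ← intervalIntegral.integral_add]
  · congr 1; ext y
    have e := exp_mul_gaussDensity hA (ν * τ) (y - x)
    rw [hβτ, mul_sub, Real.exp_sub] at e
    have e1 : (-(y - x) + ν * τ) / (σ * √τ) = (x + ν * τ - y) / (σ * √τ) := by ring
    have e2 : gaussDensity ((y - x + ν * τ) / (σ * √τ)) =
        gaussDensity ((x - ν * τ - y) / (σ * √τ)) := by
      rw [show (y - x + ν * τ) / (σ * √τ) = -((x - ν * τ - y) / (σ * √τ)) by ring]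
      unfold gaussDensity; rw [neg_sq]
    rw [e1, e2] at e
    have e3 : (y + ν * s) / (σ * √s) = ν * s / (σ * √s) + 1 / (σ * √s) * y := by ring
    have e4 : (-y + ν * s) / (σ * √s) = ν * s / (σ * √s) + -1 / (σ * √s) * y := by ring
    rw [survivalProb, hβs, e3, e4, ← e]
    have := (Real.exp_pos (-2 * ν / σ ^ 2 * x)).ne'
    field_simp
    ring
  all_goals exact Continuous.intervalIntegrable (by fun_prop) _ _

/-! ### The put price: boundary values, formula and equation -/

namespace Model

variable {m : Model}

variable (m) in
/-- The payoff of the put, before taking positive parts, in logarithmic distance to the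
barrier. -/
def logPayoff (x : ℝ) : ℝ :=
  m.E - m.R * Real.exp (-m.r * (m.T - m.T₁)) -
    (1 - m.R) * Real.exp (-m.r * (m.T - m.T₁)) * m.logSurvival x

lemma continuous_logPayoff (hσ : 0 < m.σ) (hT : m.T₁ < m.T) : Continuous m.logPayoff := by
  have := continuous_survivalProb (mul_pos hσ (Real.sqrt_pos.2 (sub_pos.2 hT)))
    (m.drift * (m.T - m.T₁))
  unfold logPayoff logSurvival
  fun_prop

lemma logPayoff_eq_zero (hR₁ : m.R < 1) {k : ℝ} (hk : m.logSurvival k = m.criticalProb) :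
    m.logPayoff k = 0 := by
  have : 0 < 1 - m.R := by linarith
  rw [logPayoff, hk, criticalProb, mul_div_cancel₀ _ (by positivity), sub_self]

variable (m) in
/-- The price of the put as a discounted Gaussian mean. -/
def putPrice (k V t : ℝ) : ℝ :=
  Real.exp (-m.r * (m.T₁ - t)) *
    gaussMean (oddExt m.logPayoff m.power k) (m.logPos V t, m.σ ^ 2 * (m.T₁ - t))

variable {k : ℝ}

lemma putPrice_terminal (hσ : 0 < m.σ) (hb : 0 < m.b) (hT : m.T₁ < m.T)
    (hgk : m.logPayoff k = 0) {V : ℝ} (hV : m.barrier m.T₁ < V) :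
    m.putPrice k V m.T₁ = m.terminalValue (m.barrier m.T₁ * Real.exp k) V := by
  have hB := barrier_pos hb m.T₁
  have hV0 : 0 < V := hB.trans hV
  have hx : 0 < Real.log (V / m.barrier m.T₁) := Real.log_pos ((one_lt_div hB).2 hV)
  have hiff : Real.log (V / m.barrier m.T₁) < k ↔ V < m.barrier m.T₁ * Real.exp k := by
    rw [Real.log_lt_iff_lt_exp (div_pos hV0 hB), div_lt_iff₀ hB, mul_comm]
  rw [putPrice, logPos_eq hb hV0]
  simp only [sub_self, mul_zero, Real.exp_zero, one_mul, add_zero]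
  rw [gaussMean_zero, oddExt, if_pos hx, terminalValue]
  by_cases h : V < m.barrier m.T₁ * Real.exp k
  · rw [indicator_of_mem (show V ∈ Iio _ from h), min_eq_left (hiff.2 h).le, logPayoff, logSurvival,
      ← survival_eq hσ hb hV0 hT, survival]
    simp
    ring
  · rw [indicator_of_notMem (show V ∉ Iio _ from h),
      min_eq_right (not_lt.1 fun h' => h (hiff.1 h')), hgk]
    simp

lemma putPrice_eq (hσ : 0 < m.σ) (hb : 0 < m.b) (hT : m.T₁ < m.T) (hk : 0 < k)
    (hgk : m.logPayoff k = 0) {V t : ℝ} (hV : 0 < V) (ht : t < m.T₁) :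
    m.putPrice k V t = Real.exp (-m.r * (m.T₁ - t)) *
      ((∫ y in (0 : ℝ)..k, gaussDensity ((Real.log (V / m.barrier t) + m.drift * (m.T₁ - t) - y) /
          (m.σ * √(m.T₁ - t))) / (m.σ * √(m.T₁ - t)) * m.logPayoff y) -
        (V / m.barrier t) ^ m.power * ∫ y in (0 : ℝ)..k,
          gaussDensity ((-Real.log (V / m.barrier t) + m.drift * (m.T₁ - t) - y) /
          (m.σ * √(m.T₁ - t))) / (m.σ * √(m.T₁ - t)) * m.logPayoff y) := by
  have hτ : 0 < m.T₁ - t := sub_pos.2 ht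
  have hA : 0 < m.σ * √(m.T₁ - t) := mul_pos hσ (Real.sqrt_pos.2 hτ)
  have hA2 : m.σ ^ 2 * (m.T₁ - t) = (m.σ * √(m.T₁ - t)) ^ 2 := by
    rw [mul_pow, Real.sq_sqrt hτ.le]
  rw [putPrice, logPos_eq hb hV, hA2, rpow_power hb hV, power_eq' hσ hτ,
    gaussMean_oddExt (continuous_logPayoff hσ hT) hk hgk hA]

lemma putPrice_barrier (hσ : 0 < m.σ) (hb : 0 < m.b) (hT : m.T₁ < m.T) (hk : 0 < k)
    (hgk : m.logPayoff k = 0) {t : ℝ} (ht : t < m.T₁) : m.putPrice k (m.barrier t) t = 0 := by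
  have hB := barrier_pos hb t
  rw [putPrice_eq hσ hb hT hk hgk hB ht, div_self hB.ne']
  simp

/-- The closed form is used at x and, for the image, at -x. In the latter the inner factor e^{-βx}
cancels (V/V_b)^β, so the N₂ terms with -b₁ and -b₅ carry no power. -/
lemma putPrice_eq_putFormula (hσ : 0 < m.σ) (hb : 0 < m.b) (hT : m.T₁ < m.T) (hk : 0 < k)
    (hgk : m.logPayoff k = 0) {V t : ℝ} (hV : 0 < V) (ht : t < m.T₁) :
    m.putPrice k V t = m.putFormula (m.barrier m.T₁ * Real.exp k) V t := by
  have hτ : 0 < m.T₁ - t := sub_pos.2 ht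
  have hs : 0 < m.T - m.T₁ := sub_pos.2 hT
  rw [putPrice_eq hσ hb hT hk hgk hV ht]
  unfold logPayoff logSurvival
  rw [integral_gauss_mul_survivalProb hσ hs hτ, integral_gauss_mul_survivalProb hσ hs hτ]
  have hB := barrier_pos hb t
  have hB₁ := barrier_pos hb m.T₁
  have hst : m.T - m.T₁ + (m.T₁ - t) = m.T - t := by ring
  rw [hst, neg_neg, ← power_eq hσ]
  set x := Real.log (V / m.barrier t) with hx
  set τ := m.T₁ - t with hτd
  set p := (V / m.barrier t) ^ m.power with hp
  have hpe : Real.exp (m.power * x) = p := by rw [hp, rpow_power hb hV]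
  have hpe' : p * Real.exp (m.power * -x) = 1 := by
    rw [← hpe, ← Real.exp_add]; simp
  rw [hpe]
  have hlogx : Real.log (m.barrier t / V) = -x := log_barrier_div V t
  have hxe := log_div_barrier hb hV t
  have hlogK : Real.log (m.barrier m.T₁ / (m.barrier m.T₁ * Real.exp k)) = -k := by
    rw [div_mul_cancel_left₀ hB₁.ne', Real.log_inv, Real.log_exp]
  have hlog2 : Real.log (m.barrier m.T₁ / (m.barrier m.T₁ * Real.exp k) * (m.barrier t / V)) =
      -k - x := by
    rw [Real.log_mul (by positivity) (by positivity), hlogK, hlogx]; ring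
  have hlog1 : Real.log (V / (m.barrier m.T₁ * Real.exp k)) = x - k - m.a * τ := by
    have hbar : Real.log (m.barrier m.T₁) = Real.log m.b + -m.a * (m.T - m.T₁) := by
      rw [barrier, Real.log_mul hb.ne' (Real.exp_pos _).ne', Real.log_exp]
    rw [Real.log_div hV.ne' (by positivity), Real.log_mul hB₁.ne' (Real.exp_pos _).ne',
      Real.log_exp, hx, hxe, hbar]
    ring
  have hlog5 : Real.log (V * Real.exp (m.a * (m.T - t)) /
      (m.barrier m.T₁ * Real.exp k * Real.exp (m.a * (m.T - m.T₁)))) = x - k := by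
    have hbar : Real.log (m.barrier m.T₁) = Real.log m.b + -m.a * (m.T - m.T₁) := by
      rw [barrier, Real.log_mul hb.ne' (Real.exp_pos _).ne', Real.log_exp]
    rw [Real.log_div (by positivity) (by positivity),
      Real.log_mul hV.ne' (Real.exp_pos _).ne',
      Real.log_mul (by positivity) (Real.exp_pos _).ne', Real.log_mul hB₁.ne' (Real.exp_pos _).ne',
      Real.log_exp, Real.log_exp, Real.log_exp, hx, hxe, hbar]
    ring
  have q1 : m.b₁ V t = (x + m.drift * τ) / (m.σ * √τ) := rfl
  have q1' : m.b₁' V t = (-x + m.drift * τ) / (m.σ * √τ) := by rw [b₁', hlogx]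
  have q2 : m.b₂ (m.barrier m.T₁ * Real.exp k) V t = (x + m.drift * τ - k) / (m.σ * √τ) := by
    rw [b₂, hlog1, drift, ← hτd]; ring
  have q2' : m.b₂' (m.barrier m.T₁ * Real.exp k) V t = (-x + m.drift * τ - k) / (m.σ * √τ) := by
    rw [b₂', hlog2, ← hτd]; ring
  have q3 : -m.b₁ V t = (-x - m.drift * τ) / (m.σ * √τ) := by rw [q1]; ring
  have q3' : -m.b₁' V t = (x - m.drift * τ) / (m.σ * √τ) := by rw [q1']; ring
  have q5 : -m.b₅ (m.barrier m.T₁ * Real.exp k) V t = (-x - m.drift * τ - k) / (m.σ * √τ) := by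
    rw [b₅, hlog2, ← hτd]; ring
  have q5' : -m.b₅' (m.barrier m.T₁ * Real.exp k) V t = (x - m.drift * τ - k) / (m.σ * √τ) := by
    rw [b₅', hlog5, ← hτd]; ring
  have q6 : m.d₁ V t = (x + m.drift * (m.T - t)) / (m.σ * √(m.T - t)) := rfl
  have q7 : m.d₂ V t = (-x + m.drift * (m.T - t)) / (m.σ * √(m.T - t)) := by rw [d₂, hlogx]
  have q8 : m.corr t = √(τ / (m.T - t)) := rfl
  have hexp : Real.exp (-m.r * (m.T - t)) =
      Real.exp (-m.r * τ) * Real.exp (-m.r * (m.T - m.T₁)) := by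
    rw [← Real.exp_add, hτd]; congr 1; ring
  unfold putFormula
  rw [q3, q3', q5, q5', q1, q1', q2, q2', q6, q7, q8, hexp, ← hp]
  rw [← hτd]
  linear_combination (-(Real.exp (-m.r * τ) * ((1 - m.R) * Real.exp (-m.r * (m.T - m.T₁))) *
    (N₂ ((x + m.drift * (m.T - t)) / (m.σ * √(m.T - t))) ((-x - m.drift * τ) / (m.σ * √τ))
      (-√(τ / (m.T - t))) -
    N₂ ((x + m.drift * (m.T - t)) / (m.σ * √(m.T - t))) ((-x - m.drift * τ - k) / (m.σ * √τ))
      (-√(τ / (m.T - t)))))) * hpe'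

/-- The summand 0 is the time shift δ of `hasDerivAt_of_isHeat`. -/
lemma putPrice_eq_heat (hσ : 0 < m.σ) (hgk : m.logPayoff k = 0) {t : ℝ} (ht : t < m.T₁) (V : ℝ) :
    m.putPrice k V t = Real.exp (-m.r * (m.T₁ - t)) * (1 / √(2 * Real.pi) *
      (fun p : ℝ × ℝ => gaussFactor p * moment k (oddExt m.logPayoff m.power k)
        (p.1 / p.2, 1 / (2 * p.2))) (m.logPos V t, m.σ ^ 2 * (m.T₁ - t) + 0)) := by
  have hτ : 0 < m.T₁ - t := sub_pos.2 ht
  rw [putPrice, gaussMean_eq_moment (fun y hy => oddExt_of_notMem hgk hy) _ (by positivity),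
    add_zero]

lemma continuousAt_logPos {z : ℝ × ℝ} (hz : 0 < z.1) (δ : ℝ) :
    ContinuousAt (fun z : ℝ × ℝ => (m.logPos z.1 z.2, m.σ ^ 2 * (m.T₁ - z.2) + δ)) z := by
  have := hz.ne'
  unfold logPos
  fun_prop (disch := assumption)

lemma isPutPrice_putPrice (hσ : 0 < m.σ) (hb : 0 < m.b) (hT : m.T₁ < m.T)
    (hk : 0 < k) (hgk : m.logPayoff k = 0) :
    m.IsPutPrice (m.barrier m.T₁ * Real.exp k) (m.putPrice k) := by
  have hg := continuous_logPayoff hσ hT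
  have hm := measurable_oddExt (β := m.power) (k := k) hg
  obtain ⟨C, hC⟩ := exists_bound_oddExt (β := m.power) hg hk hgk
  obtain ⟨h₁, h₂, hh⟩ := isHeat_moment hm (fun y (_ : y ∈ Icc (-k) k) => hC y)
  set h : ℝ × ℝ → ℝ := fun p => gaussFactor p * moment k (oddExt m.logPayoff m.power k)
    (p.1 / p.2, 1 / (2 * p.2)) with hh_def
  have hpos : ∀ z ∈ m.domain, 0 < z.1 := fun z hz => (barrier_pos hb z.2).trans hz.2.2
  have hS : ∀ t, t < m.T₁ → 0 < m.σ ^ 2 * (m.T₁ - t) + 0 := fun t ht => by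
    have : 0 < m.T₁ - t := sub_pos.2 ht
    positivity
  -- The Gaussian mean of a bounded function is bounded, so growth of degree 0 suffices.
  refine ⟨?_, ⟨Real.exp (|m.r| * m.T₁) * C, 0, ?_⟩, ?_, fun t _ ht =>
    putPrice_barrier hσ hb hT hk hgk ht, fun V hV => putPrice_terminal hσ hb hT hgk hV⟩
  · rintro ⟨V, t⟩ hz
    obtain ⟨h0, h1, h2, h3⟩ := hz
    simp only at h0 h1 h2
    have hV0 : 0 < V := (barrier_pos hb t).trans_le h2
    refine ContinuousAt.continuousWithinAt ?_
    have hmap := continuousAt_logPos (m := m) (z := (V, t)) hV0 0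
    have he : Continuous fun z : ℝ × ℝ => Real.exp (-m.r * (m.T₁ - z.2)) := by fun_prop
    rcases h1.lt_or_eq with h1 | rfl
    · have hc : ContinuousAt h (m.logPos V t, m.σ ^ 2 * (m.T₁ - t) + 0) :=
        (hh.hasFDerivAt _ (hS t h1)).continuousAt
      have hcomp := ContinuousAt.comp (f := fun z : ℝ × ℝ =>
        (m.logPos z.1 z.2, m.σ ^ 2 * (m.T₁ - z.2) + 0)) (x := (V, t)) hc hmap
      refine (he.continuousAt.mul (hcomp.const_mul (1 / √(2 * Real.pi)))).congr ?_
      have hev : ∀ᶠ z : ℝ × ℝ in 𝓝 (V, t), z.2 < m.T₁ :=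
        continuous_snd.continuousAt.eventually_lt_const h1
      filter_upwards [hev] with z hz
      exact (putPrice_eq_heat hσ hgk hz z.1).symm
    -- At time T₁, excluding the corner forces x > 0, where the extended payoff is continuous.
    · have hV : m.barrier m.T₁ < V := lt_of_le_of_ne h2 fun h => h3 (by rw [h])
      have hx : 0 < m.logPos V m.T₁ := by
        rw [logPos_eq hb hV0, sub_self, mul_zero, add_zero]
        exact Real.log_pos ((one_lt_div (barrier_pos hb _)).2 hV)
      have hc := continuousAt_gaussMean hm hC
        (continuousAt_oddExt (β := m.power) (k := k) hg hx)
      have hcomp := ContinuousAt.comp (f := fun z : ℝ × ℝ =>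
        (m.logPos z.1 z.2, m.σ ^ 2 * (m.T₁ - z.2) + 0)) (x := (V, m.T₁)) (by simpa using hc) hmap
      refine (he.continuousAt.mul hcomp).congr (.of_forall fun z => ?_)
      simp [Function.uncurry, putPrice]
  · rintro V t ⟨h0, h1, -, -⟩
    simp only at h0 h1
    rw [putPrice, abs_mul, abs_of_pos (Real.exp_pos _)]
    have hC0 : 0 ≤ C := (abs_nonneg _).trans (hC 0)
    have hτ : 0 ≤ m.T₁ - t := by linarith
    have e1 : -m.r * (m.T₁ - t) ≤ |m.r| * m.T₁ := by
      calc -m.r * (m.T₁ - t) ≤ |m.r| * (m.T₁ - t) := by gcongr; exact neg_le_abs m.r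
        _ ≤ _ := by gcongr; linarith
    calc _ ≤ Real.exp (|m.r| * m.T₁) * C := by gcongr; exact abs_gaussMean_le hC _
      _ ≤ Real.exp (|m.r| * m.T₁) * C * (1 + V ^ 0) :=
        le_mul_of_one_le_right (by positivity) (by simp)
  · have hmapD : ContinuousOn (fun z : ℝ × ℝ =>
        (m.logPos z.1 z.2, m.σ ^ 2 * (m.T₁ - z.2) + 0)) m.domain := fun z hz =>
      (continuousAt_logPos (hpos z hz) 0).continuousWithinAt
    have hmaps : MapsTo (fun z : ℝ × ℝ =>
        (m.logPos z.1 z.2, m.σ ^ 2 * (m.T₁ - z.2) + 0)) m.domain {p | 0 < p.2} :=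
      fun z hz => hS z.2 hz.2.1
    have c0 := hh.continuousOn.comp hmapD hmaps
    have c1 := hh.continuousOn₁.comp hmapD hmaps
    have c2 := hh.continuousOn₂.comp hmapD hmaps
    simp only [Function.comp_def] at c0 c1 c2
    have he : ContinuousOn (fun z : ℝ × ℝ => Real.exp (-m.r * (m.T₁ - z.2))) m.domain :=
      Continuous.continuousOn (by fun_prop)
    have hne : ∀ z ∈ m.domain, z.1 ≠ 0 := fun z hz => (hpos z hz).ne'
    have hne2 : ∀ z ∈ m.domain, z.1 ^ 2 ≠ 0 := fun z hz => pow_ne_zero _ (hpos z hz).ne'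
    refine ⟨fun V t => Real.exp (-m.r * (m.T₁ - t)) * (1 / √(2 * Real.pi) *
        (m.r * h (m.logPos V t, m.σ ^ 2 * (m.T₁ - t) + 0) +
        (-(m.a + m.drift) * h₁ (m.logPos V t, m.σ ^ 2 * (m.T₁ - t) + 0)
        - m.σ ^ 2 / 2 * h₂ (m.logPos V t, m.σ ^ 2 * (m.T₁ - t) + 0)))),
      fun V t => Real.exp (-m.r * (m.T₁ - t)) * (1 / √(2 * Real.pi) *
        (h₁ (m.logPos V t, m.σ ^ 2 * (m.T₁ - t) + 0) / V)),
      fun V t => Real.exp (-m.r * (m.T₁ - t)) * (1 / √(2 * Real.pi) *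
        ((h₂ (m.logPos V t, m.σ ^ 2 * (m.T₁ - t) + 0)
        - h₁ (m.logPos V t, m.σ ^ 2 * (m.T₁ - t) + 0)) / V ^ 2)), ?_, ?_, ?_, ?_⟩
    · exact he.mul (continuousOn_const.mul ((continuousOn_const.mul c0).add
        ((continuousOn_const.mul c1).sub (continuousOn_const.mul c2))))
    · exact he.mul (continuousOn_const.mul (c1.div continuousOn_fst hne))
    · exact he.mul (continuousOn_const.mul ((c2.sub c1).div (continuousOn_fst.pow 2) hne2))
    · intro V t hz
      have hV := hpos _ hz
      have ht : t < m.T₁ := hz.2.1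
      obtain ⟨d1, d2, d3⟩ := m.hasDerivAt_of_isHeat hh hV (hS t ht)
      refine ⟨?_, ?_, ?_, ?_⟩
      · have he : HasDerivAt (fun s => Real.exp (-m.r * (m.T₁ - s)))
            (m.r * Real.exp (-m.r * (m.T₁ - t))) t := by
          have := (((hasDerivAt_id t).const_sub m.T₁).const_mul (-m.r)).exp
          refine this.congr_deriv ?_
          simp; ring
        refine HasDerivAt.hasDerivWithinAt ?_
        refine HasDerivAt.congr_of_eventuallyEq (f := fun s => Real.exp (-m.r * (m.T₁ - s)) *
          (1 / √(2 * Real.pi) * h (m.logPos V s, m.σ ^ 2 * (m.T₁ - s) + 0))) ?_ ?_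
        · refine (he.mul (d1.const_mul (1 / √(2 * Real.pi)))).congr_deriv ?_
          ring
        · filter_upwards [eventually_lt_nhds ht] with s hs
          exact putPrice_eq_heat hσ hgk hs V
      · refine ((d2.const_mul (1 / √(2 * Real.pi))).const_mul
          (Real.exp (-m.r * (m.T₁ - t)))).congr_of_eventuallyEq (.of_forall fun v => ?_)
        exact putPrice_eq_heat hσ hgk ht v
      · exact (d3.const_mul (1 / √(2 * Real.pi))).const_mul _
      · rw [putPrice_eq_heat hσ hgk ht]
        linear_combination Real.exp (-m.r * (m.T₁ - t)) * (1 / √(2 * Real.pi)) *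
          m.equation_of_isHeat (h₁ (m.logPos V t, m.σ ^ 2 * (m.T₁ - t) + 0))
            (h₂ (m.logPos V t, m.σ ^ 2 * (m.T₁ - t) + 0)) hV

end Model

end BondOption

end

/-! ### The theorem -/

theorem theorem4 (m : BondOption.Model) (hσ : 0 < m.σ) (hb : 0 < m.b)
    (hR₀ : 0 ≤ m.R) (hR₁ : m.R < 1) (hT₁ : 0 < m.T₁) (hT : m.T₁ < m.T)
    (hE₁ : Real.exp (-m.r * (m.T - m.T₁)) * m.R < m.E)
    (hE₂ : m.E < Real.exp (-m.r * (m.T - m.T₁))) :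
    (∃! K : ℝ, m.IsRedemptionBoundary K) ∧
    ∀ K : ℝ, m.IsRedemptionBoundary K →
      (∀ V, m.barrier m.T₁ < V →
        max (m.E - m.bondPrice V m.T₁) 0 = m.terminalValue K V) ∧
      (∃ P : ℝ → ℝ → ℝ, m.IsPutPrice K P) ∧
      ∀ P : ℝ → ℝ → ℝ, m.IsPutPrice K P →
        ∀ V t, 0 ≤ t → t < m.T₁ → m.barrier t ≤ V → P V t = m.putFormula K V t := by
  obtain ⟨k, hk, hkθ, hiff⟩ :=
    BondOption.Model.exists_logBoundary hσ hb hR₁ hT hE₁ hE₂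
  have hgk := BondOption.Model.logPayoff_eq_zero hR₁ hkθ
  refine ⟨⟨_, (hiff _).2 rfl, fun K hK => (hiff K).1 hK⟩, fun K hK => ?_⟩
  obtain rfl := (hiff K).1 hK
  have hsol := BondOption.Model.isPutPrice_putPrice hσ hb hT hk hgk
  refine ⟨fun V hV => BondOption.Model.payoff_eq_terminalValue hK hV, ⟨_, hsol⟩,
    fun P hP V t h0 ht hV => ?_⟩
  have hV0 : 0 < V := (BondOption.Model.barrier_pos hb t).trans_le hV
  rw [← BondOption.Model.putPrice_eq_putFormula hσ hb hT hk hgk hV0 ht]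
  -- Inside the domain, comparison in both directions gives equality; on the default barrier both
  -- functions vanish.
  rcases hV.lt_or_eq with hV | rfl
  · exact le_antisymm (hP.le hσ hb hT hsol ⟨h0, ht, hV⟩) (hsol.le hσ hb hT hP ⟨h0, ht, hV⟩)
  · rw [hP.boundary t h0 ht, hsol.boundary t h0 ht]
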